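/- **Setting.** Let $G$ be an undirected simple graph on $\{1,\dots,n\}$ with maximum degree $d$. Let $F$ be its oriented incidence matrix: the row of the edge $(i,j)$, $i<j$, has $-1$ in column $i$, $+1$ in column $j$ and $0$ elsewhere. The graph difference operators are $\Delta^{(1)}=F$ and $\Delta^{(k+1)}=F^T\Delta^{(k)}$ for odd $k$, $\Delta^{(k+1)}=F\Delta^{(k)}$ for even $k\ge 2$. Fix an integer $k\ge 0$. Consider the linear model $y=X\beta^*+\varepsilon$ with $X\in\mathbb{R}^{N\times n}$, where $\|\Delta^{(k+1)}\beta^*\|_0\le s_1$ and $\|\beta^*\|_0\le s_2$ with integers $s_1,s_2\ge 1$, and let $$\hat\beta\in\operatorname*{argmin}_{\beta\in\mathbb{R}^n}\ \frac{1}{2N}\|y-X\beta\|_2^2+\lambda_g\|\Delta^{(k+1)}\beta\|_1+\lambda\|\beta\|_1 .$$ A real random variable $Z$ is $\sigma$-sub-Gaussian if $\mathbb{E}Z=0$ and $\mathbb{E}e^{tZ}\le e^{\sigma^2t^2/2}$ for all $t\in\mathbb{R}$; a random vector $Z$ is $\sigma$-sub-Gaussian if $\mathbb{E}Z=0$ and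 $u^TZ$ is $\sigma$-sub-Gaussian for every unit vector $u$. **Assumptions.** Let $\sigma_x,c,c'>0$ and $0\le\nu<1$ be constants. The rows of $X$ are i.i.d. draws from a $\sigma_x$-sub-Gaussian distribution with covariance matrix $\Sigma_x$, all of whose eigenvalues lie in $[c,c']$. The components of $\varepsilon$ are i.i.d. draws from a $\sigma_\varepsilon$-sub-Gaussian distribution, $\sigma_\varepsilon>0$, and $\varepsilon$ is independent of $X$. Moreover $s_2/s_1\ge\nu$. **Theorem.** There are constants $c_0,C_0>0$, depending only on $k,\sigma_x,c,c',\nu$, with the following property. Let $c_1$ be any constant, and consider any sequence of such models (in which $N,n,s_1,s_2,\sigma_\varepsilon$, the graph, $\beta^*$ and the distributions may all vary) with $N\to\infty$, $n\ge 2$, $N\ge C_0\,s_2\log n$, and with tuning parameters $$c_0\,\sigma_\varepsilon\sqrt{\frac{\log n}{N}}\le\lambda\le c_1\,\sigma_\varepsilon\sqrt{\frac{\log n}{N}},\qquad \lambda_g=\lambda\sqrt{\frac{\nu}{(2d)^{k+1}}}$$ (for a graph without edges the penalty $\|\Delta^{(k+1)}\beta\|_1$ vanishes and the value of $\lambda_g$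 is irrelevant). Then $$\|\hat\beta-\beta^*\|_2=\mathcal{O}_{\mathbb P}\!\left(\sigma_\varepsilon\sqrt{\frac{s_2\log n}{N}}\right),\qquad \|\hat\beta-\beta^*\|_1=\mathcal{O}_{\mathbb P}\!\left(\sigma_\varepsilon s_2\sqrt{\frac{\log n}{N}}\right),$$ $$\frac1N\|X(\hat\beta-\beta^*)\|_2^2=\mathcal{O}_{\mathbb P}\!\left(\sigma_\varepsilon^2\,\frac{s_2\log n}{N}\right).$$ Here $Y=\mathcal{O}_{\mathbb P}(a)$ along the sequence means: for every $\delta>0$ there is $M>0$ such that $\mathbb{P}(|Y|>Ma)\le\delta$ for all sufficiently late members of the sequence. -/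

import Mathlib

open MeasureTheory ProbabilityTheory Filter
open scoped Matrix Topology

noncomputable section

namespace GraphLasso

/-- The `ℓ₁`-norm of a finitely indexed real vector. -/
def l1Norm {ι : Type*} [Fintype ι] (v : ι → ℝ) : ℝ := ∑ i, |v i|

/-- The `ℓ₂`-norm of a finitely indexed real vector. -/
def l2Norm {ι : Type*} [Fintype ι] (v : ι → ℝ) : ℝ := Real.sqrt (∑ i, v i ^ 2)

section Graph

variable {n : ℕ} (G : SimpleGraph (Fin n))

/-- The edges of `G`, each one written as the pair `(i, j)` with `i < j`. -/
abbrev OrientedEdge : Type := {e : Fin n × Fin n // e.1 < e.2 ∧ G.Adj e.1 e.2}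

open Classical in
instance : Fintype (OrientedEdge G) := Subtype.fintype _

/-- The oriented incidence matrix `F`: the row of the edge `(i, j)`, `i < j`, has `-1` in column
`i`, `+1` in column `j`, and `0` elsewhere. -/
def orientedIncidence : Matrix (OrientedEdge G) (Fin n) ℝ :=
  Matrix.of fun e v => if v = e.1.1 then -1 else if v = e.1.2 then 1 else 0

/-- The index type of the rows of `Δ^(k+1)`: edges for even `k`, nodes for odd `k`. -/
def DiffRow : ℕ → Type
  | 0 => OrientedEdge G
  | 1 => Fin n
  | k + 2 => DiffRow k

instance instFintypeDiffRow : ∀ k : ℕ, Fintype (DiffRow G k)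
  | 0 => inferInstanceAs (Fintype (OrientedEdge G))
  | 1 => inferInstanceAs (Fintype (Fin n))
  | k + 2 => instFintypeDiffRow k

/-- The matrix that turns `Δ^(k+1)` into `Δ^(k+2)`: it is `Fᵀ` for even `k` and `F` for odd `k`. -/
def diffStep : ∀ k : ℕ, Matrix (DiffRow G (k + 1)) (DiffRow G k) ℝ
  | 0 => (orientedIncidence G)ᵀ
  | 1 => orientedIncidence G
  | k + 2 => diffStep k

/-- `graphDiff G k` is the graph difference operator `Δ^(k+1)`: `Δ^(1) = F`, and successive
operators arise by multiplying from the left by `Fᵀ` and by `F` alternately. -/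
def graphDiff : ∀ k : ℕ, Matrix (DiffRow G k) (Fin n) ℝ
  | 0 => orientedIncidence G
  | k + 1 => diffStep G k * graphDiff k

open Classical in
/-- The maximum degree of `G`. -/
def maxDeg : ℕ := G.maxDegree

/-- The class of vectors `β` with at most `s₁` non-zero entries of `Δ^(k+1) β` and at most `s₂`
non-zero entries of `β`. -/
def sparseClass (k s₁ s₂ : ℕ) : Set (Fin n → ℝ) :=
  {β | hammingNorm (graphDiff G k *ᵥ β) ≤ s₁ ∧ hammingNorm β ≤ s₂}

/-- The objective function of the `k`-th order Graph-Piecewise-Polynomial-Lasso. -/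
def objective (k : ℕ) {N : ℕ} (X : Matrix (Fin N) (Fin n) ℝ) (y : Fin N → ℝ) (lamg lam : ℝ)
    (β : Fin n → ℝ) : ℝ :=
  1 / (2 * (N : ℝ)) * l2Norm (y - X *ᵥ β) ^ 2
    + lamg * l1Norm (graphDiff G k *ᵥ β) + lam * l1Norm β

/-- `b` is a `k`-th order Graph-Piecewise-Polynomial-Lasso estimate for the data `X`, `y`. -/
def IsEstimate (k : ℕ) {N : ℕ} (X : Matrix (Fin N) (Fin n) ℝ) (y : Fin N → ℝ) (lamg lam : ℝ)
    (b : Fin n → ℝ) : Prop :=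
  IsMinOn (objective G k X y lamg lam) Set.univ b

end Graph

section Probability

variable {Ω : Type*} [MeasurableSpace Ω]

/-- A real random variable is `σ`-sub-Gaussian: mean zero, and `E exp (t Z) ≤ exp (σ² t² / 2)` for
all real `t` (the expectation being finite). -/
structure IsSubGaussian (σ : ℝ) (Z : Ω → ℝ) (P : Measure Ω) : Prop where
  mean_zero : ∫ ω, Z ω ∂P = 0
  integrable_exp : ∀ t : ℝ, Integrable (fun ω => Real.exp (t * Z ω)) P
  mgf_le : ∀ t : ℝ, ∫ ω, Real.exp (t * Z ω) ∂P ≤ Real.exp (σ ^ 2 * t ^ 2 / 2)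

/-- A random vector is `σ`-sub-Gaussian: mean zero, and `uᵀ Z` is `σ`-sub-Gaussian for every unit
vector `u`. -/
structure IsSubGaussianVec {n : ℕ} (σ : ℝ) (Z : Ω → Fin n → ℝ) (P : Measure Ω) : Prop where
  mean_zero : ∀ i, ∫ ω, Z ω i ∂P = 0
  dot : ∀ u : Fin n → ℝ, l2Norm u = 1 → IsSubGaussian σ (fun ω => u ⬝ᵥ Z ω) P

/-- `X` is a row-wise `(σ, S)`-sub-Gaussian random matrix: its rows are i.i.d. draws from a
`σ`-sub-Gaussian distribution with covariance matrix `S`. -/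
structure IsRowwiseSubGaussian {N n : ℕ} (σ : ℝ) (S : Matrix (Fin n) (Fin n) ℝ)
    (X : Ω → Matrix (Fin N) (Fin n) ℝ) (P : Measure Ω) : Prop where
  measurable : ∀ i j, Measurable fun ω => X ω i j
  indep : iIndepFun (fun (i : Fin N) (ω : Ω) => (X ω i : Fin n → ℝ)) P
  ident : ∀ i i' : Fin N,
    IdentDistrib (fun ω => (X ω i : Fin n → ℝ)) (fun ω => (X ω i' : Fin n → ℝ)) P P
  subGaussian : ∀ i, IsSubGaussianVec σ (fun ω => (X ω i : Fin n → ℝ)) P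
  covariance : ∀ i a b, cov[fun ω => X ω i a, fun ω => X ω i b; P] = S a b

/-- The components of the noise vector are i.i.d. draws from a `σ`-sub-Gaussian distribution. -/
structure IsSubGaussianNoise {N : ℕ} (σ : ℝ) (ε : Ω → Fin N → ℝ) (P : Measure Ω) : Prop where
  measurable : ∀ i, Measurable fun ω => ε ω i
  indep : iIndepFun (fun (i : Fin N) (ω : Ω) => ε ω i) P
  ident : ∀ i i' : Fin N, IdentDistrib (fun ω => ε ω i) (fun ω => ε ω i') P P
  subGaussian : ∀ i, IsSubGaussian σ (fun ω => ε ω i) P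

end Probability

/-- `Y_j = O_P(a_j)` as `j → ∞`, where `Y_j` lives on its own probability space `(Ω_j, P_j)`:
for every `δ > 0` there is `M > 0` such that `P_j (|Y_j| > M a_j) ≤ δ` for all large `j`. -/
def IsBigOP {Ω : ℕ → Type*} [∀ j, MeasurableSpace (Ω j)] (P : ∀ j, Measure (Ω j))
    (Y : ∀ j, Ω j → ℝ) (a : ℕ → ℝ) : Prop :=
  ∀ δ : ℝ, 0 < δ → ∃ M : ℝ, 0 < M ∧
    ∀ᶠ j in atTop, P j {ω | M * a j < |Y j ω|} ≤ ENNReal.ofReal δ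

end GraphLasso

end

/-! Write e for the error of the estimate. Comparing the objective at the estimate and at the truth
gives `basic_inequality`. Its graph part costs no more than a usual Lasso term: `Δ^(k+1)` has
operator norm at most (2d)^((k+1)/2), so with the given `λ_g` and ν ≤ s₂/s₁ the contribution `λ_g`
√s₁ ‖Δe‖₂ is at most λ √s₂ ‖e‖₂ (`graph_penalty_le`). If the noise correlations max_a |(Xᵀε)_a|/N
are at most λ/2, then e lies in the cone ‖e‖₁ ≤ 6 √s₂ ‖e‖₂, and a restricted eigenvalue bound on
this cone yields all three rates (`error_bounds`).

The restricted eigenvalue bound comes from Maurey's empirical method. A Chernoff bound and a union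
bound give ‖Xz‖² ≥ N (c/2) ‖z‖² for all sums z of m signed unit vectors, with m of order s₂. Any v
is, up to scale, the mean of such random sums, and `gram_lower_bound_of_signedSum` transfers the
bound to v at the price of a multiple of ‖v‖₁²/m, which is absorbed on the cone.

The noise event fails with probability about 2/n, which is not small when n stays bounded. Since the
constant c₀ must not depend on δ, `exists_error_bound` treats bounded n separately: there the cone
condition with r = n holds for every vector, and domination of the noise by λ is not needed. -/

noncomputable section

namespace GraphLasso

/-! ### Norm inequalities and decomposability of the ℓ₁-norm. -/

section Norms

variable {ι : Type*} [Fintype ι]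

lemma l1Norm_nonneg (v : ι → ℝ) : 0 ≤ l1Norm v :=
  Finset.sum_nonneg fun _ _ => abs_nonneg _

lemma l2Norm_nonneg (v : ι → ℝ) : 0 ≤ l2Norm v := Real.sqrt_nonneg _

lemma l2Norm_sq (v : ι → ℝ) : l2Norm v ^ 2 = ∑ i, v i ^ 2 :=
  Real.sq_sqrt (Finset.sum_nonneg fun _ _ => sq_nonneg _)

lemma l2Norm_sq_eq_dotProduct (v : ι → ℝ) : l2Norm v ^ 2 = v ⬝ᵥ v := by
  rw [l2Norm_sq]
  exact Finset.sum_congr rfl fun i _ => sq _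

lemma dotProduct_le_l2Norm_mul (u v : ι → ℝ) : u ⬝ᵥ v ≤ l2Norm u * l2Norm v :=
  Real.sum_mul_le_sqrt_mul_sqrt _ _ _

lemma sum_abs_le_sqrt_card_mul_l2Norm (s : Finset ι) (e : ι → ℝ) :
    ∑ i ∈ s, |e i| ≤ Real.sqrt s.card * l2Norm e := by
  have h := Real.sum_mul_le_sqrt_mul_sqrt s (fun _ => (1 : ℝ)) (fun i => |e i|)
  simp only [one_mul, one_pow, Finset.sum_const, nsmul_eq_mul, mul_one, sq_abs] at h
  refine h.trans ?_
  gcongr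
  exact Real.sqrt_le_sqrt
    (Finset.sum_le_sum_of_subset_of_nonneg (Finset.subset_univ s) fun _ _ _ => sq_nonneg _)

lemma l1Norm_le_sqrt_card_mul_l2Norm (e : ι → ℝ) :
    l1Norm e ≤ Real.sqrt (Fintype.card ι) * l2Norm e :=
  sum_abs_le_sqrt_card_mul_l2Norm Finset.univ e

lemma l2Norm_smul (t : ℝ) (v : ι → ℝ) : l2Norm (t • v) = |t| * l2Norm v := by
  simp only [l2Norm, Pi.smul_apply, smul_eq_mul, mul_pow, ← Finset.mul_sum]
  rw [Real.sqrt_mul (sq_nonneg t), Real.sqrt_sq_eq_abs]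

/-- Decomposability of the `ℓ₁`-norm over the support of `a`. -/
lemma l1Norm_sub_l1Norm_add_le (a e : ι → ℝ) :
    l1Norm a - l1Norm (a + e) ≤ 2 * (Real.sqrt (hammingNorm a) * l2Norm e) - l1Norm e := by
  have h1 := sum_abs_le_sqrt_card_mul_l2Norm (Finset.univ.filter fun i => a i ≠ 0) e
  have h2 : l1Norm a - l1Norm (a + e)
      ≤ 2 * ∑ i ∈ Finset.univ.filter (fun i => a i ≠ 0), |e i| - l1Norm e := by
    rw [Finset.sum_filter, Finset.mul_sum, l1Norm, l1Norm, l1Norm, ← Finset.sum_sub_distrib,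
      ← Finset.sum_sub_distrib]
    refine Finset.sum_le_sum fun i _ => ?_
    by_cases hi : a i = 0
    · simp [hi]
    · have h3 := abs_sub_abs_le_abs_sub (a i) (a i + e i)
      rw [sub_add_cancel_left, abs_neg] at h3
      simp only [Pi.add_apply, ne_eq, hi, not_false_eq_true, if_true]
      linarith
  have h4 : (Finset.univ.filter fun i => a i ≠ 0).card = hammingNorm a := rfl
  rw [h4] at h1
  linarith

/-- For the graph penalty: the part of the perturbation off the support is discarded, and only an ℓ₂
bound is kept. -/
lemma l1Norm_sub_l1Norm_add_le_sqrt (a e : ι → ℝ) :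
    l1Norm a - l1Norm (a + e) ≤ Real.sqrt (hammingNorm a) * l2Norm e := by
  have h1 := sum_abs_le_sqrt_card_mul_l2Norm (Finset.univ.filter fun i => a i ≠ 0) e
  have h2 : l1Norm a - l1Norm (a + e)
      ≤ ∑ i ∈ Finset.univ.filter (fun i => a i ≠ 0), |e i| := by
    rw [Finset.sum_filter, l1Norm, l1Norm, ← Finset.sum_sub_distrib]
    refine Finset.sum_le_sum fun i _ => ?_
    by_cases hi : a i = 0
    · simp [hi]
    · have h3 := abs_sub_abs_le_abs_sub (a i) (a i + e i)
      rw [sub_add_cancel_left, abs_neg] at h3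
      simpa [hi] using h3
  exact h2.trans h1

end Norms

/-! ### Operator norm of the graph difference operators. -/

section OperatorBound

variable {n : ℕ} (G : SimpleGraph (Fin n))

lemma orientedIncidence_mulVec_apply (w : Fin n → ℝ) (e : OrientedEdge G) :
    (orientedIncidence G *ᵥ w) e = w e.1.2 - w e.1.1 := by
  have hne : e.1.1 ≠ e.1.2 := ne_of_lt e.2.1
  have h : ∀ v, orientedIncidence G e v * w v
      = (if v = e.1.2 then w v else 0) - (if v = e.1.1 then w v else 0) := by
    intro v
    simp only [orientedIncidence, Matrix.of_apply]
    by_cases h1 : v = e.1.1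
    · subst h1
      simp [hne]
    · by_cases h2 : v = e.1.2 <;> simp [h1, h2, hne.symm]
  simp [Matrix.mulVec, dotProduct, h, Finset.sum_sub_distrib]

open Classical in
-- Sending an incident edge to its other endpoint is injective into the neighbours of `v`.
lemma card_incident_le_maxDeg (v : Fin n) :
    (Finset.univ.filter fun e : OrientedEdge G => v = e.1.1 ∨ v = e.1.2).card ≤ maxDeg G := by
  have h1 : G.degree v ≤ maxDeg G := G.degree_le_maxDegree v
  refine le_trans ?_ h1
  rw [← SimpleGraph.card_neighborFinset_eq_degree]
  refine Finset.card_le_card_of_injOn (fun e => if v = e.1.1 then e.1.2 else e.1.1) ?_ ?_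
  · rintro ⟨⟨a, b⟩, hlt, hadj⟩ he
    simp only [Finset.coe_filter, Finset.mem_univ, true_and, Set.mem_ofPred_eq] at he
    simp only [SimpleGraph.coe_neighborFinset, SimpleGraph.mem_neighborSet]
    rcases he with rfl | rfl
    · simpa using hadj
    · simpa [(ne_of_lt hlt).symm] using hadj.symm
  · rintro ⟨⟨a, b⟩, hlt, hadj⟩ he ⟨⟨a', b'⟩, hlt', hadj'⟩ he' heq
    simp only [Finset.coe_filter, Finset.mem_univ, true_and, Set.mem_ofPred_eq] at he he' hlt hlt' heq
    simp only [Subtype.mk.injEq, Prod.mk.injEq]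
    split_ifs at heq <;> grind

/-- Uses (x - y)² ≤ 2x² + 2y² on each edge; summing over edges counts each vertex at most `maxDeg G`
times. -/
lemma l2Norm_orientedIncidence_mulVec_sq_le (w : Fin n → ℝ) :
    l2Norm (orientedIncidence G *ᵥ w) ^ 2 ≤ 2 * maxDeg G * l2Norm w ^ 2 := by
  classical
  rw [l2Norm_sq, l2Norm_sq]
  calc ∑ e, (orientedIncidence G *ᵥ w) e ^ 2
      ≤ ∑ e : OrientedEdge G, ∑ v, if v = e.1.1 ∨ v = e.1.2 then 2 * w v ^ 2 else 0 := by
        refine Finset.sum_le_sum fun e _ => ?_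
        have hne : e.1.1 ≠ e.1.2 := ne_of_lt e.2.1
        have h : ∀ v, (if v = e.1.1 ∨ v = e.1.2 then 2 * w v ^ 2 else 0)
            = (if v = e.1.1 then 2 * w v ^ 2 else 0)
              + (if v = e.1.2 then 2 * w v ^ 2 else 0) := by
          intro v
          by_cases h1 : v = e.1.1
          · subst h1
            simp [hne]
          · simp [h1]
        simp only [h, Finset.sum_add_distrib, Finset.sum_ite_eq', Finset.mem_univ, if_true]
        rw [orientedIncidence_mulVec_apply]
        nlinarith [sq_nonneg (w e.1.1 + w e.1.2)]
    _ = ∑ v, (Finset.univ.filter fun e : OrientedEdge G => v = e.1.1 ∨ v = e.1.2).card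
          * (2 * w v ^ 2) := by
        rw [Finset.sum_comm]
        refine Finset.sum_congr rfl fun v _ => ?_
        rw [← Finset.sum_filter, Finset.sum_const, nsmul_eq_mul]
    _ ≤ ∑ v, (maxDeg G : ℝ) * (2 * w v ^ 2) := by
        refine Finset.sum_le_sum fun v _ => ?_
        gcongr
        exact_mod_cast card_incident_le_maxDeg G v
    _ = 2 * maxDeg G * ∑ v, w v ^ 2 := by
        rw [← Finset.mul_sum, ← Finset.mul_sum]
        ring

/-- A matrix and its transpose have the same operator norm: ‖Aᵀz‖² = ⟨z, AAᵀz⟩ ≤ ‖z‖ ‖AAᵀz‖, then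
one factor ‖Aᵀz‖² is cancelled after squaring. -/
lemma l2Norm_transpose_mulVec_sq_le {ι κ : Type*} [Fintype ι] [Fintype κ] {A : Matrix ι κ ℝ}
    {C : ℝ} (hC : 0 ≤ C) (hA : ∀ w, l2Norm (A *ᵥ w) ^ 2 ≤ C * l2Norm w ^ 2) (z : ι → ℝ) :
    l2Norm (Aᵀ *ᵥ z) ^ 2 ≤ C * l2Norm z ^ 2 := by
  have h1 : l2Norm (Aᵀ *ᵥ z) ^ 2 ≤ l2Norm z * l2Norm (A *ᵥ (Aᵀ *ᵥ z)) := by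
    rw [l2Norm_sq_eq_dotProduct]
    refine le_trans (le_of_eq ?_) (dotProduct_le_l2Norm_mul _ _)
    rw [Matrix.dotProduct_mulVec z A, ← Matrix.mulVec_transpose]
  have h2 := hA (Aᵀ *ᵥ z)
  have h3 := l2Norm_nonneg (Aᵀ *ᵥ z)
  rcases h3.eq_or_lt with h | h
  · rw [← h, zero_pow two_ne_zero]
    exact mul_nonneg hC (sq_nonneg _)
  · have h4 : (l2Norm (Aᵀ *ᵥ z) ^ 2) ^ 2
        ≤ l2Norm z ^ 2 * (C * l2Norm (Aᵀ *ᵥ z) ^ 2) := by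
      calc (l2Norm (Aᵀ *ᵥ z) ^ 2) ^ 2 ≤ (l2Norm z * l2Norm (A *ᵥ (Aᵀ *ᵥ z))) ^ 2 := by gcongr
        _ = l2Norm z ^ 2 * l2Norm (A *ᵥ (Aᵀ *ᵥ z)) ^ 2 := by ring
        _ ≤ _ := by gcongr
    have h5 : 0 < l2Norm (Aᵀ *ᵥ z) ^ 2 := by positivity
    nlinarith

lemma l2Norm_diffStep_mulVec_sq_le : ∀ (k : ℕ) (w : DiffRow G k → ℝ),
    l2Norm (diffStep G k *ᵥ w) ^ 2 ≤ 2 * maxDeg G * l2Norm w ^ 2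
  | 0, w => l2Norm_transpose_mulVec_sq_le (A := orientedIncidence G) (by positivity)
      (l2Norm_orientedIncidence_mulVec_sq_le G) w
  | 1, w => l2Norm_orientedIncidence_mulVec_sq_le G w
  | k + 2, w => l2Norm_diffStep_mulVec_sq_le k w

/-- The operator norm of `Δ^(k+1)` is at most `(2d)^((k+1)/2)`. -/
lemma l2Norm_graphDiff_mulVec_sq_le (k : ℕ) (v : Fin n → ℝ) :
    l2Norm (graphDiff G k *ᵥ v) ^ 2 ≤ (2 * maxDeg G) ^ (k + 1) * l2Norm v ^ 2 := by
  induction k with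
  | zero =>
    rw [zero_add, pow_one]
    exact l2Norm_orientedIncidence_mulVec_sq_le G v
  | succ k ih =>
    have h : graphDiff G (k + 1) *ᵥ v = diffStep G k *ᵥ (graphDiff G k *ᵥ v) := by
      rw [Matrix.mulVec_mulVec]
      rfl
    rw [h]
    refine (l2Norm_diffStep_mulVec_sq_le G k _).trans ?_
    calc _ ≤ 2 * (maxDeg G : ℝ) * ((2 * maxDeg G) ^ (k + 1) * l2Norm v ^ 2) := by gcongr
      _ = _ := by ring

/-- This is what the calibration of `lamg` is for: the factor (2d)^(k+1) cancels, leaving √(ν s₁) ≤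
√s₂. -/
lemma graph_penalty_le {k s₁ s₂ : ℕ} {ν lam lamg : ℝ} (hlam : 0 ≤ lam) (hs₁ : 0 < s₁)
    (hν0 : 0 ≤ ν) (hν : ν ≤ (s₂ : ℝ) / s₁)
    (hlamg : lamg = lam * Real.sqrt (ν / (2 * (maxDeg G : ℝ)) ^ (k + 1))) (e : Fin n → ℝ) :
    lamg * (Real.sqrt s₁ * l2Norm (graphDiff G k *ᵥ e)) ≤ lam * (Real.sqrt s₂ * l2Norm e) := by
  have hs : (0 : ℝ) < s₁ := by exact_mod_cast hs₁
  rw [hlamg, mul_assoc]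
  refine mul_le_mul_of_nonneg_left ?_ hlam
  set D : ℝ := (2 * (maxDeg G : ℝ)) ^ (k + 1) with hD
  have hD0 : 0 ≤ D := by positivity
  have h1 : l2Norm (graphDiff G k *ᵥ e) ≤ Real.sqrt D * l2Norm e := by
    refine abs_le_of_sq_le_sq' ?_ (by have := l2Norm_nonneg e; positivity) |>.2
    rw [mul_pow, Real.sq_sqrt hD0]
    exact l2Norm_graphDiff_mulVec_sq_le G k e
  have h2 : ν / D * D ≤ ν := by
    -- For an edgeless graph `D = 0`, so `ν / D = 0` by convention and the product is still at most
    -- `ν`.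
    rcases hD0.eq_or_lt with h | h
    · rw [← h]
      simpa using hν0
    · rw [div_mul_cancel₀ _ h.ne']
  calc Real.sqrt (ν / D) * (Real.sqrt s₁ * l2Norm (graphDiff G k *ᵥ e))
      ≤ Real.sqrt (ν / D) * (Real.sqrt s₁ * (Real.sqrt D * l2Norm e)) := by gcongr
    _ = Real.sqrt (ν / D * D * s₁) * l2Norm e := by
        rw [Real.sqrt_mul (by positivity), Real.sqrt_mul (by positivity)]
        ring
    _ ≤ Real.sqrt s₂ * l2Norm e := by
        refine mul_le_mul_of_nonneg_right (Real.sqrt_le_sqrt ?_) (l2Norm_nonneg e)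
        calc ν / D * D * s₁ ≤ ν * s₁ := by gcongr
          _ ≤ (s₂ : ℝ) / s₁ * s₁ := by gcongr
          _ = s₂ := div_mul_cancel₀ _ hs.ne'

end OperatorBound

/-! ### Deterministic analysis of the estimator. -/

section Deterministic

variable {n N : ℕ} (G : SimpleGraph (Fin n))

lemma dotProduct_mulVec_le_l1Norm {X : Matrix (Fin N) (Fin n) ℝ} {E : Fin N → ℝ} {η : ℝ}
    (hη : ∀ a, |∑ i, X i a * E i| ≤ η) (e : Fin n → ℝ) : E ⬝ᵥ (X *ᵥ e) ≤ η * l1Norm e := by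
  have h : E ⬝ᵥ (X *ᵥ e) = ∑ a, (∑ i, X i a * E i) * e a := by
    simp only [dotProduct, Matrix.mulVec, Finset.mul_sum, Finset.sum_mul]
    rw [Finset.sum_comm]
    exact Finset.sum_congr rfl fun a _ => Finset.sum_congr rfl fun i _ => by ring
  rw [h, l1Norm, Finset.mul_sum]
  refine Finset.sum_le_sum fun a _ => ?_
  refine (le_abs_self _).trans ?_
  rw [abs_mul]
  exact mul_le_mul_of_nonneg_right (hη a) (abs_nonneg _)

/-- The basic inequality for the error of a Graph-Piecewise-Polynomial-Lasso estimate. -/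
lemma basic_inequality {k s₁ s₂ : ℕ} {X : Matrix (Fin N) (Fin n) ℝ} {E : Fin N → ℝ}
    {b bh : Fin n → ℝ} {ν lam lamg η : ℝ} (hN : 0 < N) (hlam : 0 ≤ lam) (hs₁ : 0 < s₁)
    (hν0 : 0 ≤ ν) (hν : ν ≤ (s₂ : ℝ) / s₁)
    (hlamg : lamg = lam * Real.sqrt (ν / (2 * (maxDeg G : ℝ)) ^ (k + 1)))
    (hb : b ∈ sparseClass G k s₁ s₂)
    (hmin : IsEstimate G k X (X *ᵥ b + E) lamg lam bh)
    (hη : ∀ a, |∑ i, X i a * E i| ≤ N * η) :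
    1 / (2 * (N : ℝ)) * l2Norm (X *ᵥ (bh - b)) ^ 2
      ≤ 3 * lam * (Real.sqrt s₂ * l2Norm (bh - b)) + (η - lam) * l1Norm (bh - b) := by
  have hN' : (0 : ℝ) < N := by exact_mod_cast hN
  have hlamg0 : 0 ≤ lamg := by rw [hlamg]; positivity
  obtain ⟨e, rfl⟩ : ∃ e, bh = b + e := ⟨bh - b, by simp⟩
  rw [add_sub_cancel_left]
  have h0 : objective G k X (X *ᵥ b + E) lamg lam (b + e)
      ≤ objective G k X (X *ᵥ b + E) lamg lam b := hmin (Set.mem_univ b)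
  have h1 : X *ᵥ b + E - X *ᵥ (b + e) = E - X *ᵥ e := by
    rw [Matrix.mulVec_add]
    abel
  have h2 : l2Norm (E - X *ᵥ e) ^ 2
      = l2Norm E ^ 2 - 2 * (E ⬝ᵥ (X *ᵥ e)) + l2Norm (X *ᵥ e) ^ 2 := by
    simp only [l2Norm_sq_eq_dotProduct, sub_dotProduct, dotProduct_sub]
    rw [dotProduct_comm (X *ᵥ e) E]
    ring
  rw [objective, objective, h1, add_sub_cancel_left, h2, Matrix.mulVec_add] at h0
  have h3 := dotProduct_mulVec_le_l1Norm hη e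
  have h4 := l1Norm_sub_l1Norm_add_le b e
  have h5 := l1Norm_sub_l1Norm_add_le_sqrt (graphDiff G k *ᵥ b) (graphDiff G k *ᵥ e)
  have h6 := graph_penalty_le G (k := k) hlam hs₁ hν0 hν hlamg e
  have h7 : Real.sqrt (hammingNorm (graphDiff G k *ᵥ b)) ≤ Real.sqrt s₁ :=
    Real.sqrt_le_sqrt (by exact_mod_cast hb.1)
  have h8 : Real.sqrt (hammingNorm b) ≤ Real.sqrt s₂ :=
    Real.sqrt_le_sqrt (by exact_mod_cast hb.2)
  -- The constant 3 in the conclusion is 1 from this graph term plus 2 from the Lasso term `h10`.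
  have h9 : lamg * (l1Norm (graphDiff G k *ᵥ b)
      - l1Norm (graphDiff G k *ᵥ b + graphDiff G k *ᵥ e)) ≤ lam * (Real.sqrt s₂ * l2Norm e) :=
    (mul_le_mul_of_nonneg_left
      (h5.trans (mul_le_mul_of_nonneg_right h7 (l2Norm_nonneg _))) hlamg0).trans h6
  have h10 : lam * (l1Norm b - l1Norm (b + e))
      ≤ lam * (2 * (Real.sqrt s₂ * l2Norm e) - l1Norm e) := by
    refine mul_le_mul_of_nonneg_left (h4.trans ?_) hlam
    have := mul_le_mul_of_nonneg_right h8 (l2Norm_nonneg e)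
    linarith
  have h11 : 1 / (2 * (N : ℝ)) * (2 * (E ⬝ᵥ (X *ᵥ e))) ≤ η * l1Norm e := by
    calc 1 / (2 * (N : ℝ)) * (2 * (E ⬝ᵥ (X *ᵥ e)))
        ≤ 1 / (2 * (N : ℝ)) * (2 * (N * η * l1Norm e)) := by gcongr
      _ = η * l1Norm e := by field_simp
  linarith

/-- From the basic inequality and restricted strong convexity to the error bounds. -/
lemma error_bounds {s κ B τ x y z : ℝ} (hκ : 0 < κ) (hs : 0 ≤ s) (hB : 0 ≤ B)
    (hτ : 0 ≤ τ) (hx : 0 ≤ x) (hy : y ≤ B * (Real.sqrt s * x))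
    (hz : z ≤ B * τ * (Real.sqrt s * x)) (hre : κ * x ^ 2 ≤ z) :
    x ≤ B / κ * (τ * Real.sqrt s) ∧ y ≤ B ^ 2 / κ * (τ * s) ∧
      z ≤ B ^ 2 / κ * (τ ^ 2 * s) := by
  have h1 : x ≤ B / κ * (τ * Real.sqrt s) := by
    rcases hx.eq_or_lt with h | h
    · rw [← h]
      positivity
    · have h2 : κ * x * x ≤ B * τ * Real.sqrt s * x := by nlinarith
      have h3 := le_of_mul_le_mul_right h2 h
      rw [div_mul_eq_mul_div, le_div_iff₀ hκ]
      linarith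
  have hss : Real.sqrt s * Real.sqrt s = s := Real.mul_self_sqrt hs
  refine ⟨h1, ?_, ?_⟩
  · calc y ≤ B * (Real.sqrt s * x) := hy
      _ ≤ B * (Real.sqrt s * (B / κ * (τ * Real.sqrt s))) := by gcongr
      _ = B ^ 2 / κ * (τ * (Real.sqrt s * Real.sqrt s)) := by ring
      _ = _ := by rw [hss]
  · calc z ≤ B * τ * (Real.sqrt s * x) := hz
      _ ≤ B * τ * (Real.sqrt s * (B / κ * (τ * Real.sqrt s))) := by gcongr
      _ = B ^ 2 / κ * (τ ^ 2 * (Real.sqrt s * Real.sqrt s)) := by ring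
      _ = _ := by rw [hss]

end Deterministic

/-! ### Maurey's empirical method for the Gram form. -/

section Sparsification

/-- One step of the sampling argument: if `v` is the mean of the atoms `a i` with weights `p i`,
some step `a i - v` increases the form by at most its mean increase. -/
lemma exists_bilin_add_sub_le {V ι : Type*} [AddCommGroup V] [Module ℝ V] [Fintype ι]
    (B : LinearMap.BilinForm ℝ V) {p : ι → ℝ} {a : ι → V} {v : V} (hp0 : ∀ i, 0 ≤ p i)
    (hp1 : ∑ i, p i = 1) (hv : ∑ i, p i • a i = v) (w : V) :
    ∃ i, B (w + (a i - v)) (w + (a i - v))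
      ≤ B w w + (∑ i, p i * B (a i) (a i) - B v v) := by
  have hl : ∀ u, ∑ i, p i * B (a i) u = B v u := by
    intro u
    rw [← hv, map_sum, LinearMap.sum_apply]
    simp
  have hr : ∀ u, ∑ i, p i * B u (a i) = B u v := by
    intro u
    rw [← hv, map_sum]
    simp
  have hc : ∀ t : ℝ, ∑ i, p i * t = t := by
    intro t
    rw [← Finset.sum_mul, hp1, one_mul]
  set c := B w w + (∑ i, p i * B (a i) (a i) - B v v) with hcdef
  -- The cross terms vanish because `a i - v` has weighted mean zero. A weighted mean equal to `c`
  -- cannot have all its values above `c`; neither symmetry nor positivity of `B` enters.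
  have hsum : ∑ i, p i * (B (w + (a i - v)) (w + (a i - v)) - c) = 0 := by
    have h : ∀ i, p i * (B (w + (a i - v)) (w + (a i - v)) - c)
        = p i * (B w w - B w v - B v w + B v v - c) + p i * B w (a i) + p i * B (a i) w
          - p i * B (a i) v - p i * B v (a i) + p i * B (a i) (a i) := by
      intro i
      simp only [map_add, map_sub, LinearMap.add_apply, LinearMap.sub_apply]
      ring
    simp only [h, Finset.sum_add_distrib, Finset.sum_sub_distrib, hl, hr, hc]
    rw [hcdef]
    ring
  by_contra! hcon
  have hz := (Finset.sum_eq_zero_iff_of_nonneg fun i _ =>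
    mul_nonneg (hp0 i) (sub_pos.mpr (hcon i)).le).mp hsum
  have hp : ∀ i, p i = 0 := fun i =>
    (mul_eq_zero.mp (hz i (Finset.mem_univ i))).resolve_right (sub_pos.mpr (hcon i)).ne'
  simp [hp] at hp1

/-- Derandomized second moment of a sum of `l` independent draws: the atoms are picked one at a
time, each adding at most the variance-like term. -/
lemma exists_bilin_add_sum_sub_le {V ι : Type*} [AddCommGroup V] [Module ℝ V] [Fintype ι]
    (B : LinearMap.BilinForm ℝ V) {p : ι → ℝ} {a : ι → V} {v : V} (hp0 : ∀ i, 0 ≤ p i)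
    (hp1 : ∑ i, p i = 1) (hv : ∑ i, p i • a i = v) (l : ℕ) (w : V) :
    ∃ f : Fin l → ι, B (w + ∑ j, (a (f j) - v)) (w + ∑ j, (a (f j) - v))
      ≤ B w w + l * (∑ i, p i * B (a i) (a i) - B v v) := by
  induction l generalizing w with
  | zero => exact ⟨Fin.elim0, by simp⟩
  | succ l ih =>
    obtain ⟨i, hi⟩ := exists_bilin_add_sub_le B hp0 hp1 hv w
    obtain ⟨f, hf⟩ := ih (w + (a i - v))
    refine ⟨Fin.cons i f, ?_⟩
    simp only [Fin.sum_univ_succ, Fin.cons_zero, Fin.cons_succ]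
    rw [← add_assoc]
    push_cast
    linarith

variable {n N : ℕ}

/-- The sum of the signed unit vectors listed by `g`. -/
def signedSum {m : ℕ} (g : Fin m → Fin n × Bool) : Fin n → ℝ :=
  ∑ j, (if (g j).2 then (1 : ℝ) else -1) • Pi.single (g j).1 1

/-- Subtracting κ times the identity turns the desired lower bound into nonnegativity of a possibly
indefinite form. -/
lemma gram_bilin_apply (X : Matrix (Fin N) (Fin n) ℝ) (κ : ℝ) (x : Fin n → ℝ) :
    Matrix.toBilin' ((1 / (N : ℝ)) • (Xᵀ * X) - κ • (1 : Matrix (Fin n) (Fin n) ℝ)) x x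
      = 1 / (N : ℝ) * l2Norm (X *ᵥ x) ^ 2 - κ * l2Norm x ^ 2 := by
  rw [Matrix.toBilin'_apply', Matrix.sub_mulVec, Matrix.smul_mulVec, Matrix.smul_mulVec,
    Matrix.one_mulVec, dotProduct_sub, dotProduct_smul, dotProduct_smul, smul_eq_mul, smul_eq_mul,
    ← Matrix.mulVec_mulVec, Matrix.dotProduct_mulVec x Xᵀ, Matrix.vecMul_transpose,
    l2Norm_sq_eq_dotProduct, l2Norm_sq_eq_dotProduct]

/-- A lower bound for the quadratic form of the Gram matrix at sparse integer vectors extends to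
all vectors, up to a multiple of the squared `ℓ₁`-norm. -/
lemma gram_lower_bound_of_signedSum {X : Matrix (Fin N) (Fin n) ℝ} {κ Γ : ℝ} {m : ℕ}
    (hN : 0 < N) (hm : 2 ≤ m) (hκ : 0 ≤ κ) (hdiag : ∀ a, ∑ i, X i a ^ 2 ≤ N * Γ)
    (hpts : ∀ g : Fin m → Fin n × Bool,
      N * (κ * l2Norm (signedSum g) ^ 2) ≤ l2Norm (X *ᵥ signedSum g) ^ 2) (v : Fin n → ℝ) :
    κ * l2Norm v ^ 2 - 2 * Γ / m * l1Norm v ^ 2 ≤ 1 / (N : ℝ) * l2Norm (X *ᵥ v) ^ 2 := by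
  have hN' : (0 : ℝ) < N := by exact_mod_cast hN
  have hm' : (2 : ℝ) ≤ m := by exact_mod_cast hm
  rcases (l1Norm_nonneg v).eq_or_lt with h0 | hR
  · have hv0 : v = 0 := by
      have h1 := (Finset.sum_eq_zero_iff_of_nonneg fun i _ => abs_nonneg (v i)).mp h0.symm
      funext i
      simpa using h1 i (Finset.mem_univ i)
    subst hv0
    simp [l2Norm, l1Norm]
  set R := l1Norm v with hRdef
  set B := Matrix.toBilin' ((1 / (N : ℝ)) • (Xᵀ * X) - κ • (1 : Matrix (Fin n) (Fin n) ℝ))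
    with hB
  have hBx : ∀ x, B x x = 1 / (N : ℝ) * l2Norm (X *ᵥ x) ^ 2 - κ * l2Norm x ^ 2 :=
    gram_bilin_apply X κ
  -- The sign is taken as 1 at zero, so that `σ i ^ 2 = 1` throughout.
  let σ : Fin n → ℝ := fun i => if 0 ≤ v i then 1 else -1
  have hσ : ∀ i, σ i ^ 2 = 1 := by
    intro i
    simp only [σ]
    split_ifs <;> norm_num
  have hσv : ∀ i, |v i| * σ i = v i := by
    intro i
    simp only [σ]
    split_ifs with h
    · rw [abs_of_nonneg h, mul_one]
    · rw [abs_of_neg (not_le.mp h)]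
      ring
  let a : Fin n → Fin n → ℝ := fun i => R • (σ i • Pi.single i 1)
  let p : Fin n → ℝ := fun i => |v i| / R
  have hp0 : ∀ i, 0 ≤ p i := fun i => by positivity
  have hp1 : ∑ i, p i = 1 := by
    simp only [p]
    rw [← Finset.sum_div]
    exact div_self hR.ne'
  have hv : ∑ i, p i • a i = v := by
    have h : ∀ i, p i • a i = Pi.single i (v i) := by
      intro i
      simp only [p, a, smul_smul]
      rw [← mul_assoc, div_mul_cancel₀ _ hR.ne', hσv, ← Pi.single_smul', smul_eq_mul, mul_one]
    simp only [h]
    exact Finset.univ_sum_single v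
  -- Starting from `m • v` cancels the subtracted copies of `v`, leaving a pure sum of `m` atoms, to
  -- which `hpts` applies.
  obtain ⟨f, hf⟩ := exists_bilin_add_sum_sub_le B hp0 hp1 hv m ((m : ℝ) • v)
  have hw : (m : ℝ) • v + ∑ j, (a (f j) - v)
      = R • signedSum (fun j => (f j, decide (0 ≤ v (f j)))) := by
    rw [Finset.sum_sub_distrib, Finset.sum_const, Finset.card_univ, Fintype.card_fin,
      ← Nat.cast_smul_eq_nsmul ℝ, add_sub_cancel, signedSum, Finset.smul_sum]
    simp [a, σ]
  rw [hw] at hf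
  have hnn : 0 ≤ B (R • signedSum (fun j => (f j, decide (0 ≤ v (f j)))))
      (R • signedSum (fun j => (f j, decide (0 ≤ v (f j))))) := by
    rw [map_smul, map_smul, LinearMap.smul_apply, smul_eq_mul, smul_eq_mul, hBx]
    have h1 := hpts (fun j => (f j, decide (0 ≤ v (f j))))
    have h2 : κ * l2Norm (signedSum (fun j => (f j, decide (0 ≤ v (f j))))) ^ 2
        ≤ 1 / (N : ℝ) * l2Norm (X *ᵥ signedSum (fun j => (f j, decide (0 ≤ v (f j))))) ^ 2 := by
      rw [one_div, ← div_eq_inv_mul, le_div_iff₀ hN']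
      linarith
    exact mul_nonneg hR.le (mul_nonneg hR.le (by linarith))
  have hatom : ∀ i, B (a i) (a i) ≤ R ^ 2 * Γ := by
    intro i
    have h1 : l2Norm (X *ᵥ (Pi.single i (1 : ℝ))) ^ 2 = ∑ j, X j i ^ 2 := by
      rw [l2Norm_sq]
      simp
    have h2 : B (a i) (a i) = R ^ 2 * B (Pi.single i 1) (Pi.single i 1) := by
      simp only [a, map_smul, LinearMap.smul_apply, smul_eq_mul]
      linear_combination R ^ 2 * B (Pi.single i 1) (Pi.single i 1) * hσ i
    rw [h2, hBx, h1]
    have h3 : 1 / (N : ℝ) * ∑ j, X j i ^ 2 ≤ Γ := by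
      rw [one_div, ← div_eq_inv_mul, div_le_iff₀ hN']
      linarith [hdiag i]
    have h4 : 0 ≤ κ * l2Norm (Pi.single i (1 : ℝ) : Fin n → ℝ) ^ 2 := by positivity
    gcongr
    linarith
  have hmean : ∑ i, p i * B (a i) (a i) ≤ R ^ 2 * Γ := by
    calc ∑ i, p i * B (a i) (a i) ≤ ∑ i, p i * (R ^ 2 * Γ) :=
          Finset.sum_le_sum fun i _ => mul_le_mul_of_nonneg_left (hatom i) (hp0 i)
      _ = R ^ 2 * Γ := by rw [← Finset.sum_mul, hp1, one_mul]
  simp only [map_smul, LinearMap.smul_apply, smul_eq_mul] at hf hnn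
  have hq := hBx v
  set q := B v v
  suffices h : -(2 * Γ / m * R ^ 2) ≤ q by linarith
  have hm0 : (0 : ℝ) < m := by linarith
  have h1 : 0 ≤ (m : ℝ) * (m * q) + m * (R ^ 2 * Γ - q) := by
    have := mul_le_mul_of_nonneg_left (sub_le_sub_right hmean q) hm0.le
    linarith
  have h2 : 0 ≤ (m : ℝ) * q + (R ^ 2 * Γ - q) := by
    have : 0 ≤ (m : ℝ) * (m * q + (R ^ 2 * Γ - q)) := by linarith
    exact nonneg_of_mul_nonneg_right this hm0
  have hΓ : 0 ≤ R ^ 2 * Γ := by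
    obtain ⟨i⟩ : Nonempty (Fin n) := by
      by_contra hne
      rw [not_nonempty_iff] at hne
      simp at hp1
    have h3 : 0 ≤ (N : ℝ) * Γ :=
      (Finset.sum_nonneg fun j _ => sq_nonneg (X j i)).trans (hdiag i)
    have := nonneg_of_mul_nonneg_right h3 hN'
    positivity
  have h3 : -(2 * Γ / m * R ^ 2) = -(2 * (R ^ 2 * Γ)) / m := by ring
  rw [h3, div_le_iff₀ hm0]
  -- From `h2`, (m - 1) q ≥ -R²Γ; for negative `q`, m ≤ 2(m - 1) gives m q ≥ -2R²Γ. This is where `2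
  -- ≤ m` and the factor 2 come from.
  by_cases hqs : 0 ≤ q
  · have : 0 ≤ q * m := by positivity
    linarith
  · nlinarith

end Sparsification

/-! ### Moments and tail bounds for scalar sub-Gaussian variables. -/

section ScalarSubGaussian

variable {Ω : Type*} [MeasurableSpace Ω] {P : Measure Ω}

lemma IsSubGaussian.hasSubgaussianMGF {σ : ℝ} {Z : Ω → ℝ} (h : IsSubGaussian σ Z P) :
    HasSubgaussianMGF Z ⟨σ ^ 2, sq_nonneg σ⟩ P :=
  ⟨h.integrable_exp, fun t => h.mgf_le t⟩

lemma pow_four_le_exp_add_exp_neg (y : ℝ) : y ^ 4 ≤ 24 * (Real.exp y + Real.exp (-y)) := by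
  have h1 := Real.pow_div_factorial_le_exp |y| (abs_nonneg y) 4
  have h2 : |y| ^ 4 = y ^ 4 := by
    rw [show |y| ^ 4 = (|y| ^ 2) ^ 2 by ring, sq_abs]
    ring
  have h3 : Real.exp |y| ≤ Real.exp y + Real.exp (-y) := by
    rcases abs_cases y with ⟨h, _⟩ | ⟨h, _⟩ <;> rw [h] <;>
      linarith [Real.exp_pos y, Real.exp_pos (-y)]
  rw [h2] at h1
  norm_num [Nat.factorial] at h1
  linarith

lemma IsSubGaussian.integral_pow_four_le {σ : ℝ} {W : Ω → ℝ} (hσ : 0 < σ)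
    (h : IsSubGaussian σ W P) (hm : Measurable W) :
    Integrable (fun ω => W ω ^ 4) P ∧ ∫ ω, W ω ^ 4 ∂P ≤ 96 * σ ^ 4 := by
  -- Rescaling by σ⁻¹ makes both exponential moments at most √e ≤ 2, hence 96 = 24 · (2 + 2).
  have hb : ∀ ω, W ω ^ 4
      ≤ σ ^ 4 * (24 * (Real.exp (σ⁻¹ * W ω) + Real.exp (-σ⁻¹ * W ω))) := by
    intro ω
    have h1 := pow_four_le_exp_add_exp_neg (σ⁻¹ * W ω)
    have h2 : W ω ^ 4 = σ ^ 4 * (σ⁻¹ * W ω) ^ 4 := by field_simp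
    rw [h2, neg_mul]
    gcongr
  have hi1 := h.integrable_exp σ⁻¹
  have hi2 := h.integrable_exp (-σ⁻¹)
  have hi : Integrable
      (fun ω => σ ^ 4 * (24 * (Real.exp (σ⁻¹ * W ω) + Real.exp (-σ⁻¹ * W ω)))) P :=
    ((hi1.add hi2).const_mul 24).const_mul _
  have hint : Integrable (fun ω => W ω ^ 4) P := by
    refine hi.mono' (hm.pow_const 4).aestronglyMeasurable (Eventually.of_forall fun ω => ?_)
    rw [Real.norm_of_nonneg (by positivity)]
    exact hb ω
  refine ⟨hint, (integral_mono hint hi hb).trans ?_⟩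
  rw [integral_const_mul, integral_const_mul, integral_add hi1 hi2]
  have he : Real.exp (σ ^ 2 * σ⁻¹ ^ 2 / 2) ≤ 2 := by
    rw [show σ ^ 2 * σ⁻¹ ^ 2 / 2 = 1 / 2 by field_simp]
    have h1 := Real.exp_one_lt_d9
    have h2 : Real.exp (1 / 2) * Real.exp (1 / 2) = Real.exp 1 := by
      rw [← Real.exp_add]
      norm_num
    nlinarith [Real.exp_pos (1 / 2)]
  have h1 := (h.mgf_le σ⁻¹).trans he
  have h2 := h.mgf_le (-σ⁻¹)
  rw [neg_sq] at h2
  have h3 := h2.trans he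
  have h4 : 0 < σ ^ 4 := by positivity
  calc _ ≤ σ ^ 4 * (24 * (2 + 2)) := by gcongr
    _ = 96 * σ ^ 4 := by ring

/-- Since (1 - x + x²/2)(1 + x + x²/2) = 1 + x⁴/4 ≥ 1 and the second factor is at most exp x. -/
lemma exp_neg_le_quadratic {x : ℝ} (hx : 0 ≤ x) : Real.exp (-x) ≤ 1 - x + x ^ 2 / 2 := by
  have h1 := Real.quadratic_le_exp_of_nonneg hx
  have h2 : Real.exp (-x) * Real.exp x = 1 := by
    rw [← Real.exp_add]
    simp
  have h3 : 0 < 1 - x + x ^ 2 / 2 := by nlinarith [sq_nonneg (x - 1)]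
  have h4 : 1 ≤ (1 - x + x ^ 2 / 2) * Real.exp x := by
    calc (1 : ℝ) ≤ (1 - x + x ^ 2 / 2) * (1 + x + x ^ 2 / 2) := by nlinarith [sq_nonneg (x ^ 2)]
      _ ≤ _ := by gcongr
  exact le_of_mul_le_mul_right (by rw [h2]; exact h4) (Real.exp_pos x)

/-- As -W² is bounded above, a quadratic bound on the exponential and the fourth moment suffice, for
every `θ ≥ 0`. -/
lemma IsSubGaussian.mgf_neg_sq_le [IsProbabilityMeasure P] {σ c θ : ℝ} {W : Ω → ℝ} (hσ : 0 < σ)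
    (h : IsSubGaussian σ W P) (hm : Measurable W) (hc : c ≤ ∫ ω, W ω ^ 2 ∂P) (hθ : 0 ≤ θ) :
    Integrable (fun ω => Real.exp (θ * -(W ω ^ 2))) P ∧
      mgf (fun ω => -(W ω ^ 2)) P θ ≤ Real.exp (-(θ * c) + θ ^ 2 * (48 * σ ^ 4)) := by
  obtain ⟨hi4, h4⟩ := h.integral_pow_four_le hσ hm
  have hi2 : Integrable (fun ω => W ω ^ 2) P := (h.hasSubgaussianMGF.memLp 2).integrable_sq
  have hpt : ∀ ω, Real.exp (θ * -(W ω ^ 2))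
      ≤ 1 - θ * W ω ^ 2 + θ ^ 2 / 2 * W ω ^ 4 := by
    intro ω
    have h1 := exp_neg_le_quadratic (x := θ * W ω ^ 2) (by positivity)
    rw [mul_neg]
    linarith
  have hi1 : Integrable (fun ω => 1 - θ * W ω ^ 2) P :=
    (integrable_const 1).sub (hi2.const_mul θ)
  have hir : Integrable (fun ω => 1 - θ * W ω ^ 2 + θ ^ 2 / 2 * W ω ^ 4) P :=
    hi1.add (hi4.const_mul _)
  have hil : Integrable (fun ω => Real.exp (θ * -(W ω ^ 2))) P := by
    refine hir.mono' (by fun_prop) (Eventually.of_forall fun ω => ?_)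
    rw [Real.norm_of_nonneg (Real.exp_pos _).le]
    exact hpt ω
  refine ⟨hil, ?_⟩
  have h5 : mgf (fun ω => -(W ω ^ 2)) P θ
      ≤ 1 - θ * ∫ ω, W ω ^ 2 ∂P + θ ^ 2 / 2 * ∫ ω, W ω ^ 4 ∂P := by
    refine (integral_mono hil hir hpt).trans (le_of_eq ?_)
    rw [integral_add hi1 (hi4.const_mul _),
      integral_sub (integrable_const 1) (hi2.const_mul θ), integral_const_mul,
      integral_const_mul]
    simp
  refine h5.trans ?_
  have h6 := Real.add_one_le_exp (-(θ * c) + θ ^ 2 * (48 * σ ^ 4))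
  have h7 : θ * c ≤ θ * ∫ ω, W ω ^ 2 ∂P := by gcongr
  have h8 : θ ^ 2 / 2 * ∫ ω, W ω ^ 4 ∂P ≤ θ ^ 2 / 2 * (96 * σ ^ 4) := by gcongr
  linarith

/-- Lower tail of a sum of squares of independent sub-Gaussian variables. -/
lemma measureReal_sum_sq_le_le [IsProbabilityMeasure P] {N : ℕ} {σ c : ℝ}
    {W : Fin N → Ω → ℝ} (hσ : 0 < σ) (hc : 0 ≤ c) (hind : iIndepFun W P)
    (hm : ∀ i, Measurable (W i)) (h : ∀ i, IsSubGaussian σ (W i) P)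
    (hvar : ∀ i, c ≤ ∫ ω, W i ω ^ 2 ∂P) :
    P.real {ω | ∑ i, W i ω ^ 2 ≤ N * (c / 2)} ≤ Real.exp (-(N * (c ^ 2 / (768 * σ ^ 4)))) := by
  -- The minimizer of the Chernoff exponent -θc/2 + 48σ⁴θ², whose value there is -c²/(768σ⁴).
  set θ : ℝ := c / (192 * σ ^ 4) with hθdef
  have hθ : 0 ≤ θ := by positivity
  have hind' : iIndepFun (fun i ω => -(W i ω ^ 2)) P :=
    hind.comp (fun _ x => -(x ^ 2)) fun _ => by fun_prop
  have hm' : ∀ i, Measurable (fun ω => -(W i ω ^ 2)) := fun i => by fun_prop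
  have hi : Integrable (fun ω => Real.exp (θ * (∑ i, fun ω => -(W i ω ^ 2)) ω)) P :=
    hind'.integrable_exp_mul_sum hm' fun i _ =>
      ((h i).mgf_neg_sq_le hσ (hm i) (hvar i) hθ).1
  have h1 := measure_ge_le_exp_mul_mgf (-(N * (c / 2))) hθ hi
  rw [hind'.mgf_sum hm'] at h1
  have h2 : {ω | ∑ i, W i ω ^ 2 ≤ N * (c / 2)}
      = {ω | -(N * (c / 2)) ≤ (∑ i, fun ω => -(W i ω ^ 2)) ω} := by
    ext ω
    simp [Finset.sum_apply, Finset.sum_neg_distrib]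
  rw [h2]
  refine h1.trans ?_
  have h3 : ∏ i : Fin N, mgf (fun ω => -(W i ω ^ 2)) P θ
      ≤ Real.exp (N * (-(θ * c) + θ ^ 2 * (48 * σ ^ 4))) := by
    refine (Finset.prod_le_prod (fun i _ => mgf_nonneg) fun i _ =>
      ((h i).mgf_neg_sq_le hσ (hm i) (hvar i) hθ).2).trans ?_
    simp [Real.exp_nat_mul]
  calc _ ≤ Real.exp (-θ * -(N * (c / 2)))
        * Real.exp (N * (-(θ * c) + θ ^ 2 * (48 * σ ^ 4))) := by gcongr
    _ = _ := by
        rw [← Real.exp_add, hθdef]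
        congr 1
        field_simp
        ring

/-- The exponential moment of the square of a sub-Gaussian variable is bounded. -/
lemma exists_integral_exp_sq_le {σ : ℝ} (hσ : 0 < σ) :
    ∃ s A : ℝ, 0 < s ∧ 0 < A ∧ ∀ {Ω : Type*} [MeasurableSpace Ω] (P : Measure Ω)
      [IsProbabilityMeasure P] (W : Ω → ℝ), Measurable W → IsSubGaussian σ W P →
      Integrable (fun ω => Real.exp (s * W ω ^ 2)) P ∧
        ∫ ω, Real.exp (s * W ω ^ 2) ∂P ≤ A := by
  -- Decoupling: exp(sW²) is the mean of exp(√(2s) W g) over a standard Gaussian g. Exchanging the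
  -- integrals, the sub-Gaussian bound in W leaves the mean of exp(C g²), finite by Fernique's
  -- theorem.
  obtain ⟨C, hC, hint⟩ := IsGaussian.exists_integrable_exp_sq (gaussianReal 0 1)
  refine ⟨C / σ ^ 2, ∫ x, Real.exp (C * ‖x‖ ^ 2) ∂(gaussianReal 0 1), by positivity,
    integral_exp_pos hint, ?_⟩
  intro Ω _ P _ W hm h
  set r : ℝ := Real.sqrt (2 * (C / σ ^ 2)) with hr
  have hr2 : r ^ 2 = 2 * (C / σ ^ 2) := Real.sq_sqrt (by positivity)
  have h1 : ∀ ω, ENNReal.ofReal (Real.exp (C / σ ^ 2 * W ω ^ 2))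
      = ∫⁻ g, ENNReal.ofReal (Real.exp (r * W ω * g)) ∂(gaussianReal 0 1) := by
    intro ω
    have h2 := congrFun (mgf_id_gaussianReal (μ := 0) (v := 1)) (r * W ω)
    rw [← ofReal_integral_eq_lintegral_ofReal (integrable_exp_mul_gaussianReal _)
      (Eventually.of_forall fun _ => (Real.exp_pos _).le)]
    congr 1
    simp only [mgf, id] at h2
    rw [h2]
    congr 1
    rw [mul_pow, hr2]
    push_cast
    ring
  have h3 : ∀ g : ℝ, ∫⁻ ω, ENNReal.ofReal (Real.exp (r * W ω * g)) ∂P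
      ≤ ENNReal.ofReal (Real.exp (C * ‖g‖ ^ 2)) := by
    intro g
    have h4 : ∀ ω, r * W ω * g = r * g * W ω := fun ω => by ring
    simp only [h4]
    rw [← ofReal_integral_eq_lintegral_ofReal (h.integrable_exp _)
      (Eventually.of_forall fun _ => (Real.exp_pos _).le)]
    refine ENNReal.ofReal_le_ofReal ((h.mgf_le _).trans (le_of_eq ?_))
    congr 1
    rw [mul_pow, hr2, Real.norm_eq_abs, sq_abs]
    field_simp
  have h5 : ∫⁻ ω, ENNReal.ofReal (Real.exp (C / σ ^ 2 * W ω ^ 2)) ∂P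
      ≤ ENNReal.ofReal (∫ x, Real.exp (C * ‖x‖ ^ 2) ∂(gaussianReal 0 1)) := by
    simp only [h1]
    rw [lintegral_lintegral_swap (by fun_prop), ofReal_integral_eq_lintegral_ofReal hint
      (Eventually.of_forall fun _ => (Real.exp_pos _).le)]
    exact lintegral_mono h3
  have hi : Integrable (fun ω => Real.exp (C / σ ^ 2 * W ω ^ 2)) P := by
    rw [← lintegral_ofReal_ne_top_iff_integrable (by fun_prop)
      (Eventually.of_forall fun _ => (Real.exp_pos _).le)]
    exact (h5.trans_lt ENNReal.ofReal_lt_top).ne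
  refine ⟨hi, ?_⟩
  rw [← ofReal_integral_eq_lintegral_ofReal hi
    (Eventually.of_forall fun _ => (Real.exp_pos _).le)] at h5
  exact (ENNReal.ofReal_le_ofReal_iff (integral_exp_pos hint).le).mp h5

/-- Upper tail of a sum of squares of independent sub-Gaussian variables. -/
lemma exists_measureReal_sum_sq_ge_le {σ : ℝ} (hσ : 0 < σ) :
    ∃ Γ : ℝ, 0 < Γ ∧ ∀ {Ω : Type*} [MeasurableSpace Ω] (P : Measure Ω)
      [IsProbabilityMeasure P] {N : ℕ} (W : Fin N → Ω → ℝ), (∀ i, Measurable (W i)) →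
      iIndepFun W P → (∀ i, IsSubGaussian σ (W i) P) →
      P.real {ω | N * Γ ≤ ∑ i, W i ω ^ 2} ≤ Real.exp (-N) := by
  obtain ⟨s, A, hs, hA, hsq⟩ := exists_integral_exp_sq_le hσ
  -- Chosen so that the Chernoff factor beats A^N by at least exp(-N).
  refine ⟨(1 + |Real.log A|) / s, by positivity, ?_⟩
  intro Ω _ P _ N W hm hind h
  have hind' : iIndepFun (fun i ω => W i ω ^ 2) P :=
    hind.comp (fun _ x => x ^ 2) fun _ => by fun_prop
  have hm' : ∀ i, Measurable (fun ω => W i ω ^ 2) := fun i => by fun_prop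
  have hi : Integrable (fun ω => Real.exp (s * (∑ i, fun ω => W i ω ^ 2) ω)) P :=
    hind'.integrable_exp_mul_sum hm' fun i _ => (hsq P (W i) (hm i) (h i)).1
  have h1 := measure_ge_le_exp_mul_mgf (N * ((1 + |Real.log A|) / s)) hs.le hi
  rw [hind'.mgf_sum hm'] at h1
  have h2 : {ω | N * ((1 + |Real.log A|) / s) ≤ ∑ i, W i ω ^ 2}
      = {ω | N * ((1 + |Real.log A|) / s) ≤ (∑ i, fun ω => W i ω ^ 2) ω} := by
    ext ω
    simp [Finset.sum_apply]
  rw [h2]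
  refine h1.trans ?_
  have h3 : ∏ i : Fin N, mgf (fun ω => W i ω ^ 2) P s ≤ Real.exp (N * Real.log A) := by
    refine (Finset.prod_le_prod (fun i _ => mgf_nonneg) fun i _ =>
      (hsq P (W i) (hm i) (h i)).2).trans ?_
    simp [Real.exp_nat_mul, Real.exp_log hA]
  calc _ ≤ Real.exp (-s * (N * ((1 + |Real.log A|) / s))) * Real.exp (N * Real.log A) := by
        gcongr
    _ = Real.exp (-N + N * (Real.log A - |Real.log A|)) := by
        rw [← Real.exp_add]
        congr 1
        field_simp
        ring
    _ ≤ Real.exp (-N) := by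
        refine Real.exp_le_exp.mpr ?_
        have h4 : (N : ℝ) * (Real.log A - |Real.log A|) ≤ 0 :=
          mul_nonpos_of_nonneg_of_nonpos N.cast_nonneg (by linarith [le_abs_self (Real.log A)])
        linarith

/-- Tail of a weighted sum of independent noise variables with fixed weights. -/
lemma measureReal_abs_sum_mul_gt_le [IsProbabilityMeasure P] {N : ℕ} {σ V t : ℝ}
    {ε : Ω → Fin N → ℝ} (hε : IsSubGaussianNoise σ ε P) (ht : 0 ≤ t) {z : Fin N → ℝ}
    (hz : ∑ i, z i ^ 2 ≤ V) :
    P.real {ω | t < |∑ i, z i * ε ω i|} ≤ 2 * Real.exp (-t ^ 2 / (2 * (σ ^ 2 * V))) := by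
  have hV : 0 ≤ V := (Finset.sum_nonneg fun i _ => sq_nonneg (z i)).trans hz
  have hind : iIndepFun (fun (i : Fin N) ω => z i * ε ω i) P :=
    hε.indep.comp (fun i x => z i * x) fun _ => by fun_prop
  have h1 := HasSubgaussianMGF.sum_of_iIndepFun hind (s := Finset.univ)
    fun i _ => (hε.subGaussian i).hasSubgaussianMGF.const_mul (z i)
  have h2 : HasSubgaussianMGF (fun ω => ∑ i, z i * ε ω i)
      ⟨σ ^ 2 * V, mul_nonneg (sq_nonneg σ) hV⟩ P := by
    refine ⟨h1.integrable_exp_mul, fun t => (h1.mgf_le t).trans (Real.exp_le_exp.mpr ?_)⟩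
    have h3 : ∑ i, z i ^ 2 * σ ^ 2 ≤ σ ^ 2 * V := by
      rw [← Finset.sum_mul, mul_comm]
      gcongr
    refine div_le_div_of_nonneg_right (mul_le_mul_of_nonneg_right ?_ (sq_nonneg t)) zero_le_two
    exact (NNReal.coe_sum _ _).trans_le h3
  have h5 : {ω | t < |∑ i, z i * ε ω i|}
      ⊆ {ω | t ≤ ∑ i, z i * ε ω i} ∪ {ω | t ≤ (-fun ω => ∑ i, z i * ε ω i) ω} := by
    intro ω hω
    rcases lt_abs.mp (show t < |∑ i, z i * ε ω i| from hω) with h | h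
    · exact Or.inl h.le
    · exact Or.inr h.le
  calc _ ≤ _ := measureReal_mono h5
    _ ≤ _ := measureReal_union_le _ _
    _ ≤ _ := add_le_add (h2.measure_ge_le ht) (h2.neg.measure_ge_le ht)
    _ = _ := (two_mul _).symm

/-- Tail of a weighted sum of noise variables with random weights independent of the noise. -/
lemma measureReal_abs_sum_mul_gt_le_of_indepFun [IsProbabilityMeasure P] {N : ℕ} {σ V t : ℝ}
    {x ε : Ω → Fin N → ℝ} (hx : Measurable x) (hε : IsSubGaussianNoise σ ε P)
    (hind : IndepFun x ε P) (ht : 0 ≤ t) :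
    P.real {ω | t < |∑ i, x ω i * ε ω i| ∧ ∑ i, x ω i ^ 2 ≤ V}
      ≤ 2 * Real.exp (-t ^ 2 / (2 * (σ ^ 2 * V))) := by
  have hεm : Measurable ε := measurable_pi_iff.mpr hε.measurable
  set T : Set ((Fin N → ℝ) × (Fin N → ℝ)) :=
    {q | t < |∑ i, q.1 i * q.2 i| ∧ ∑ i, q.1 i ^ 2 ≤ V} with hT
  have hm1 : Measurable fun q : (Fin N → ℝ) × (Fin N → ℝ) => |∑ i, q.1 i * q.2 i| := by
    fun_prop
  have hm2 : Measurable fun q : (Fin N → ℝ) × (Fin N → ℝ) => ∑ i, q.1 i ^ 2 := by fun_prop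
  have hTm : MeasurableSet T :=
    (measurableSet_lt measurable_const hm1).inter (measurableSet_le hm2 measurable_const)
  have hpre : {ω | t < |∑ i, x ω i * ε ω i| ∧ ∑ i, x ω i ^ 2 ≤ V}
      = (fun ω => (x ω, ε ω)) ⁻¹' T := rfl
  have : IsProbabilityMeasure (P.map x) := Measure.isProbabilityMeasure_map hx.aemeasurable
  have : IsProbabilityMeasure (P.map ε) := Measure.isProbabilityMeasure_map hεm.aemeasurable
  -- By independence the joint law is a product, so the fixed-weight bound is integrated over the
  -- weights.
  refine ENNReal.toReal_le_of_le_ofReal (by positivity) ?_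
  rw [hpre, ← Measure.map_apply (hx.prodMk hεm) hTm,
    (indepFun_iff_map_prod_eq_prod_map_map hx.aemeasurable hεm.aemeasurable).mp hind,
    Measure.prod_apply hTm]
  refine (lintegral_mono (g := fun _ =>
    ENNReal.ofReal (2 * Real.exp (-t ^ 2 / (2 * (σ ^ 2 * V))))) fun z => ?_).trans (by simp)
  by_cases hz : ∑ i, z i ^ 2 ≤ V
  · have h1 := measureReal_abs_sum_mul_gt_le hε ht hz
    rw [Measure.map_apply hεm (measurable_prodMk_left hTm)]
    refine ENNReal.le_ofReal_iff_toReal_le (measure_ne_top _ _) (by positivity) |>.mpr ?_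
    refine le_trans (measureReal_mono ?_) h1
    intro ω hω
    exact hω.1
  · have h1 : Prod.mk z ⁻¹' T = ∅ := by
      ext w
      simp only [Set.mem_preimage, Set.mem_empty_iff_false, iff_false]
      exact fun hw => hz hw.2
    simp [h1]

end ScalarSubGaussian

/-! ### Restricted eigenvalues and noise correlation for the random design. -/

section Design

variable {Ω : Type*} [MeasurableSpace Ω] {P : Measure Ω} {n N : ℕ}

lemma l2Norm_single_one (a : Fin n) : l2Norm (Pi.single a (1 : ℝ) : Fin n → ℝ) = 1 := by
  have h : ∀ i, (Pi.single a (1 : ℝ) : Fin n → ℝ) i ^ 2 = if i = a then 1 else 0 := by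
    intro i
    by_cases hi : i = a
    · subst hi
      simp
    · simp [hi]
  simp [l2Norm, h]

lemma IsSubGaussianVec.coord {σ : ℝ} {Z : Ω → Fin n → ℝ} (h : IsSubGaussianVec σ Z P)
    (a : Fin n) : IsSubGaussian σ (fun ω => Z ω a) P := by
  simpa using h.dot (Pi.single a 1) (l2Norm_single_one a)

lemma IsSubGaussianVec.integral_dotProduct_sq [IsProbabilityMeasure P] {σ : ℝ} {Z : Ω → Fin n → ℝ}
    {S : Matrix (Fin n) (Fin n) ℝ} (h : IsSubGaussianVec σ Z P)
    (hS : ∀ a b, cov[fun ω => Z ω a, fun ω => Z ω b; P] = S a b) {u : Fin n → ℝ}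
    (hu : l2Norm u = 1) : ∫ ω, (u ⬝ᵥ Z ω) ^ 2 ∂P = u ⬝ᵥ S *ᵥ u := by
  have hc : ∀ a, MemLp (fun ω => u a * Z ω a) 2 P := fun a =>
    ((h.coord a).hasSubgaussianMGF.memLp 2).const_mul (u a)
  have hd : MemLp (fun ω => u ⬝ᵥ Z ω) 2 P := (h.dot u hu).hasSubgaussianMGF.memLp 2
  have h1 : Var[fun ω => u ⬝ᵥ Z ω; P] = ∫ ω, (u ⬝ᵥ Z ω) ^ 2 ∂P := by
    rw [variance_eq_integral hd.aemeasurable, (h.dot u hu).mean_zero]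
    simp
  have h2 : Var[fun ω => u ⬝ᵥ Z ω; P] = ∑ a, ∑ b, u a * (u b * S a b) := by
    simp only [dotProduct]
    rw [variance_fun_sum hc]
    refine Finset.sum_congr rfl fun a _ => Finset.sum_congr rfl fun b _ => ?_
    rw [covariance_const_mul_left, covariance_const_mul_right, hS]
  rw [← h1, h2]
  simp only [dotProduct, Matrix.mulVec, Finset.mul_sum]
  exact Finset.sum_congr rfl fun a _ => Finset.sum_congr rfl fun b _ => by ring

lemma le_dotProduct_mulVec_of_spectrum {S : Matrix (Fin n) (Fin n) ℝ} {c : ℝ}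
    (hS : S.IsHermitian) (hspec : spectrum ℝ S ⊆ Set.Ici c) (u : Fin n → ℝ) :
    c * l2Norm u ^ 2 ≤ u ⬝ᵥ S *ᵥ u := by
  have h1 : (S - algebraMap ℝ _ c).PosSemidef := by
    rw [Matrix.posSemidef_iff_isHermitian_and_spectrum_nonneg]
    refine ⟨hS.sub ?_, ?_⟩
    · rw [Matrix.algebraMap_eq_diagonal]
      exact Matrix.isHermitian_diagonal _
    · rw [← spectrum.sub_singleton_eq]
      rintro x ⟨y, hy, z, hz, rfl⟩
      have h2 : c ≤ y := hspec hy
      rw [Set.mem_singleton_iff] at hz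
      subst hz
      exact sub_nonneg.mpr h2
  have h2 := h1.dotProduct_mulVec_nonneg u
  rw [Algebra.algebraMap_eq_smul_one, Matrix.sub_mulVec, Matrix.smul_mulVec, Matrix.one_mulVec,
    dotProduct_sub, dotProduct_smul, star_trivial, smul_eq_mul, ← l2Norm_sq_eq_dotProduct] at h2
  linarith

namespace IsRowwiseSubGaussian

variable {σ c : ℝ} {S : Matrix (Fin n) (Fin n) ℝ} {X : Ω → Matrix (Fin N) (Fin n) ℝ}

lemma integral_dotProduct_sq_ge [IsProbabilityMeasure P] (hX : IsRowwiseSubGaussian σ S X P)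
    (hspec : spectrum ℝ S ⊆ Set.Ici c) {u : Fin n → ℝ} (hu : l2Norm u = 1) (i : Fin N) :
    c ≤ ∫ ω, (u ⬝ᵥ (X ω i : Fin n → ℝ)) ^ 2 ∂P := by
  have hS : S.IsHermitian := by
    ext a b
    rw [Matrix.conjTranspose_apply, star_trivial, ← hX.covariance i, ← hX.covariance i,
      covariance_comm]
  rw [(hX.subGaussian i).integral_dotProduct_sq (hX.covariance i) hu]
  simpa [hu] using le_dotProduct_mulVec_of_spectrum hS hspec u

lemma measurable_row (hX : IsRowwiseSubGaussian σ S X P) (i : Fin N) :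
    Measurable fun ω => (X ω i : Fin n → ℝ) :=
  measurable_pi_iff.mpr (hX.measurable i)

/-- Lower tail of the quadratic form of the Gram matrix at a fixed vector. -/
lemma measureReal_l2Norm_mulVec_sq_lt_le [IsProbabilityMeasure P] (hX : IsRowwiseSubGaussian σ S X P) (hσ : 0 < σ)
    (hc : 0 ≤ c) (hspec : spectrum ℝ S ⊆ Set.Ici c) (v : Fin n → ℝ) :
    P.real {ω | l2Norm (X ω *ᵥ v) ^ 2 < N * (c / 2 * l2Norm v ^ 2)}
      ≤ Real.exp (-(N * (c ^ 2 / (768 * σ ^ 4)))) := by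
  rcases (l2Norm_nonneg v).eq_or_lt with h0 | hv
  · have h1 : {ω | l2Norm (X ω *ᵥ v) ^ 2 < N * (c / 2 * l2Norm v ^ 2)} = ∅ := by
      ext ω
      simp only [Set.mem_ofPred_eq, Set.mem_empty_iff_false, iff_false, not_lt]
      rw [← h0]
      simpa using sq_nonneg _
    rw [h1, measureReal_empty]
    positivity
  · set u : Fin n → ℝ := (l2Norm v)⁻¹ • v with hu
    have hu1 : l2Norm u = 1 := by
      rw [hu, l2Norm_smul, abs_of_pos (inv_pos.mpr hv), inv_mul_cancel₀ hv.ne']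
    have hvu : v = l2Norm v • u := by
      rw [hu, smul_smul, mul_inv_cancel₀ hv.ne', one_smul]
    have hm : Measurable fun z : Fin n → ℝ => u ⬝ᵥ z := by
      simp only [dotProduct]
      fun_prop
    have hind : iIndepFun (fun (i : Fin N) ω => u ⬝ᵥ (X ω i : Fin n → ℝ)) P :=
      hX.indep.comp (fun _ z => u ⬝ᵥ z) fun _ => hm
    refine le_trans (measureReal_mono ?_) (measureReal_sum_sq_le_le hσ hc hind
      (fun i => hm.comp (hX.measurable_row i)) (fun i => (hX.subGaussian i).dot u hu1)
      (hX.integral_dotProduct_sq_ge hspec hu1))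
    intro ω hω
    have h2 : l2Norm (X ω *ᵥ v) ^ 2
        = l2Norm v ^ 2 * ∑ i, (u ⬝ᵥ (X ω i : Fin n → ℝ)) ^ 2 := by
      have h5 := congrArg (fun z => l2Norm (X ω *ᵥ z)) hvu
      simp only [Matrix.mulVec_smul, l2Norm_smul, abs_of_pos hv] at h5
      rw [h5, mul_pow, l2Norm_sq (X ω *ᵥ u)]
      congr 1
      exact Finset.sum_congr rfl fun i _ => by rw [dotProduct_comm]; rfl
    have h3 : l2Norm (X ω *ᵥ v) ^ 2 < N * (c / 2 * l2Norm v ^ 2) := hω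
    rw [h2] at h3
    have h4 : 0 < l2Norm v ^ 2 := by positivity
    exact le_of_mul_le_mul_left (by linarith) h4

/-- A union bound over the (2n)^m lists of signed unit vectors. -/
lemma measureReal_exists_signedSum_lt_le [IsProbabilityMeasure P] (hX : IsRowwiseSubGaussian σ S X P) (hσ : 0 < σ)
    (hc : 0 ≤ c) (hspec : spectrum ℝ S ⊆ Set.Ici c) (m : ℕ) :
    P.real {ω | ∃ g : Fin m → Fin n × Bool,
        l2Norm (X ω *ᵥ signedSum g) ^ 2 < N * (c / 2 * l2Norm (signedSum g) ^ 2)}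
      ≤ (2 * n : ℝ) ^ m * Real.exp (-(N * (c ^ 2 / (768 * σ ^ 4)))) := by
  have h1 : {ω | ∃ g : Fin m → Fin n × Bool,
        l2Norm (X ω *ᵥ signedSum g) ^ 2 < N * (c / 2 * l2Norm (signedSum g) ^ 2)}
      = ⋃ g : Fin m → Fin n × Bool,
        {ω | l2Norm (X ω *ᵥ signedSum g) ^ 2 < N * (c / 2 * l2Norm (signedSum g) ^ 2)} := by
    ext ω
    simp
  rw [h1]
  refine (measureReal_iUnion_fintype_le _).trans ((Finset.sum_le_sum fun g _ =>
    hX.measureReal_l2Norm_mulVec_sq_lt_le hσ hc hspec (signedSum g)).trans (le_of_eq ?_))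
  simp [mul_comm]

lemma indep_column (hX : IsRowwiseSubGaussian σ S X P) (a : Fin n) :
    iIndepFun (fun (i : Fin N) ω => X ω i a) P :=
  hX.indep.comp (fun _ z => z a) fun _ => measurable_pi_apply a

/-- A union bound over columns; large column norms are excluded here and controlled separately. -/
lemma measureReal_exists_noise_gt_le [IsProbabilityMeasure P] (hX : IsRowwiseSubGaussian σ S X P) {σε V t : ℝ}
    {ε : Ω → Fin N → ℝ} (hε : IsSubGaussianNoise σε ε P)
    (hind : IndepFun (fun ω => fun (i : Fin N) (a : Fin n) => X ω i a) ε P) (ht : 0 ≤ t) :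
    P.real {ω | ∃ a, t < |∑ i, X ω i a * ε ω i| ∧ ∑ i, X ω i a ^ 2 ≤ V}
      ≤ n * (2 * Real.exp (-t ^ 2 / (2 * (σε ^ 2 * V)))) := by
  have h1 : {ω | ∃ a, t < |∑ i, X ω i a * ε ω i| ∧ ∑ i, X ω i a ^ 2 ≤ V}
      = ⋃ a, {ω | t < |∑ i, X ω i a * ε ω i| ∧ ∑ i, X ω i a ^ 2 ≤ V} := by
    ext ω
    simp
  have h2 : ∀ a, IndepFun (fun ω (i : Fin N) => X ω i a) ε P := fun a =>
    by
    have hφ : Measurable fun (z : Fin N → Fin n → ℝ) (i : Fin N) => z i a := by fun_prop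
    exact hind.comp hφ measurable_id
  rw [h1]
  refine (measureReal_iUnion_fintype_le _).trans ((Finset.sum_le_sum fun a _ =>
    measureReal_abs_sum_mul_gt_le_of_indepFun (measurable_pi_iff.mpr fun i => hX.measurable i a)
      hε (h2 a) ht).trans (le_of_eq ?_))
  simp

end IsRowwiseSubGaussian

/-- With high probability the design satisfies a restricted eigenvalue condition on the cone
`‖v‖₁² ≤ 36 r ‖v‖₂²`, and the correlation of the noise with the columns of the design is small. -/
lemma exists_design_constants {σ c : ℝ} (hσ : 0 < σ) (hc : 0 < c) :
    ∃ Γ C ρ : ℝ, 0 < Γ ∧ 0 < C ∧ 0 < ρ ∧ ∀ {Ω : Type*} [MeasurableSpace Ω] (P : Measure Ω)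
      [IsProbabilityMeasure P] {N n r : ℕ} {S : Matrix (Fin n) (Fin n) ℝ}
      {X : Ω → Matrix (Fin N) (Fin n) ℝ} {ε : Ω → Fin N → ℝ} {σε A : ℝ}, 0 < N → 2 ≤ n →
      0 < r → C * (r * Real.log n) ≤ N → IsRowwiseSubGaussian σ S X P →
      spectrum ℝ S ⊆ Set.Ici c → 0 < σε → IsSubGaussianNoise σε ε P →
      IndepFun (fun ω => fun (i : Fin N) (a : Fin n) => X ω i a) ε P → 0 ≤ A →
      P.real {ω | ¬ ((∀ v, l1Norm v ^ 2 ≤ 36 * (r * l2Norm v ^ 2) →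
            c / 4 * l2Norm v ^ 2 ≤ 1 / (N : ℝ) * l2Norm (X ω *ᵥ v) ^ 2) ∧
          ∀ a, |∑ i, X ω i a * ε ω i| ≤ A * (σε * Real.sqrt (N * Real.log n)))}
        ≤ 2 * Real.exp (-(ρ * N))
          + n * (2 * Real.exp (-(A ^ 2 * Real.log n / (2 * Γ)))) := by
  obtain ⟨Γ, hΓ, hup⟩ := exists_measureReal_sum_sq_ge_le hσ
  set q : ℝ := c ^ 2 / (768 * σ ^ 4) with hq
  have hq0 : 0 < q := by positivity
  -- With m = K r the loss on the cone is (2Γ/(K r)) · 36 r ‖v‖² = (72Γ/K) ‖v‖², at most (c/4) ‖v‖²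
  -- once K ≥ 288Γ/c.
  set K : ℕ := ⌈288 * Γ / c⌉₊ + 2 with hK
  have hKΓ : 288 * Γ / c ≤ K := by
    rw [hK]
    push_cast
    linarith [Nat.le_ceil (288 * Γ / c)]
  have hK2 : 2 ≤ K := by omega
  -- The term 4K/q pays for the (2n)^(Kr) ≤ exp(2KrL) signed sums with half of the exponent Nq; the
  -- 2 pays for the n columns.
  refine ⟨Γ, 4 * K / q + 2, min (q / 2) (1 / 2), hΓ, by positivity, by positivity, ?_⟩
  intro Ω _ P _ N n r S X ε σε A hN hn hr hCN hX hspec hσε hε hind hA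
  have hN' : (0 : ℝ) < N := by exact_mod_cast hN
  have hr1 : (1 : ℝ) ≤ r := by exact_mod_cast hr
  have hn2 : (2 : ℝ) ≤ n := by exact_mod_cast hn
  have hL0 : 0 < Real.log n := Real.log_pos (by linarith)
  set L := Real.log n with hL
  have hnL : (n : ℝ) = Real.exp L := (Real.exp_log (by linarith)).symm
  set t : ℝ := A * (σε * Real.sqrt (N * L)) with ht
  have ht0 : 0 ≤ t := by positivity
  have hrL : L ≤ r * L := by nlinarith
  have hN2L : 2 * L ≤ N := by
    have : 0 ≤ 4 * K / q * (r * L) := by positivity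
    linarith
  have hNK : 2 * (K * r) * L ≤ N * q / 2 := by
    have h1 : 4 * K / q * (r * L) ≤ N := by
      have : 0 ≤ 2 * (r * L) := by positivity
      linarith
    have h2 : 4 * K / q * (r * L) * q ≤ N * q := by gcongr
    have h3 : 4 * K / q * (r * L) * q = 4 * K * (r * L) := by field_simp
    linarith
  have hsub : {ω | ¬ ((∀ v, l1Norm v ^ 2 ≤ 36 * (r * l2Norm v ^ 2) →
            c / 4 * l2Norm v ^ 2 ≤ 1 / (N : ℝ) * l2Norm (X ω *ᵥ v) ^ 2) ∧
          ∀ a, |∑ i, X ω i a * ε ω i| ≤ t)}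
      ⊆ ({ω | ∃ g : Fin (K * r) → Fin n × Bool,
          l2Norm (X ω *ᵥ signedSum g) ^ 2 < N * (c / 2 * l2Norm (signedSum g) ^ 2)}
        ∪ ⋃ a, {ω | N * Γ ≤ ∑ i, X ω i a ^ 2})
        ∪ {ω | ∃ a, t < |∑ i, X ω i a * ε ω i| ∧ ∑ i, X ω i a ^ 2 ≤ N * Γ} := by
    intro ω hω
    by_contra hcon
    simp only [Set.mem_union, Set.mem_iUnion, Set.mem_ofPred_eq, not_or, not_exists, not_lt,
      not_le, not_and] at hcon
    obtain ⟨⟨hpts, hdiag⟩, hnoise⟩ := hcon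
    refine hω ⟨fun v hv => ?_, fun a => ?_⟩
    · have hm : 2 ≤ K * r := by nlinarith
      have h1 := gram_lower_bound_of_signedSum hN hm (half_pos hc).le
        (fun a => (hdiag a).le) hpts v
      refine le_trans ?_ h1
      have hKr : (0 : ℝ) < ((K * r : ℕ) : ℝ) := by positivity
      have h2 : 2 * Γ / ((K * r : ℕ) : ℝ) * l1Norm v ^ 2 ≤ c / 4 * l2Norm v ^ 2 := by
        calc 2 * Γ / ((K * r : ℕ) : ℝ) * l1Norm v ^ 2
            ≤ 2 * Γ / ((K * r : ℕ) : ℝ) * (36 * (r * l2Norm v ^ 2)) := by gcongr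
          _ = 288 * Γ / K / 4 * l2Norm v ^ 2 := by
              push_cast
              field_simp
              ring
          _ ≤ c / 4 * l2Norm v ^ 2 := by
              gcongr
              rw [div_le_iff₀ (by positivity)]
              rw [div_le_iff₀ hc] at hKΓ
              linarith
      linarith
    · by_contra hlt
      exact absurd (hnoise a (not_le.mp hlt)) (not_lt.mpr (hdiag a).le)
  have hρ1 : min (q / 2) (1 / 2) * N ≤ q / 2 * N := by
    gcongr
    exact min_le_left _ _
  have hρ2 : min (q / 2) (1 / 2) * N ≤ 1 / 2 * N := by
    gcongr
    exact min_le_right _ _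
  have hb1 : P.real {ω | ∃ g : Fin (K * r) → Fin n × Bool,
      l2Norm (X ω *ᵥ signedSum g) ^ 2 < N * (c / 2 * l2Norm (signedSum g) ^ 2)}
      ≤ Real.exp (-(min (q / 2) (1 / 2) * N)) := by
    refine (hX.measureReal_exists_signedSum_lt_le hσ hc.le hspec (K * r)).trans ?_
    calc (2 * n : ℝ) ^ (K * r) * Real.exp (-(N * q))
        ≤ (Real.exp (2 * L)) ^ (K * r) * Real.exp (-(N * q)) := by
          gcongr
          rw [two_mul L, Real.exp_add, ← hnL]
          gcongr
      _ = Real.exp (2 * (K * r) * L - N * q) := by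
          rw [← Real.exp_nat_mul, ← Real.exp_add]
          congr 1
          push_cast
          ring
      _ ≤ _ := Real.exp_le_exp.mpr (by linarith)
  have hb2 : P.real (⋃ a, {ω | N * Γ ≤ ∑ i, X ω i a ^ 2})
      ≤ Real.exp (-(min (q / 2) (1 / 2) * N)) := by
    refine (measureReal_iUnion_fintype_le _).trans ((Finset.sum_le_sum fun a _ =>
      hup P (fun i ω => X ω i a) (fun i => hX.measurable i a) (hX.indep_column a)
        (fun i => (hX.subGaussian i).coord a)).trans ?_)
    rw [Finset.sum_const, Finset.card_univ, Fintype.card_fin, nsmul_eq_mul, hnL, ← Real.exp_add]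
    exact Real.exp_le_exp.mpr (by linarith)
  have hb3 := hX.measureReal_exists_noise_gt_le (V := N * Γ) hε hind ht0
  have hexp : -t ^ 2 / (2 * (σε ^ 2 * (N * Γ))) = -(A ^ 2 * L / (2 * Γ)) := by
    rw [ht, mul_pow, mul_pow, Real.sq_sqrt (by positivity)]
    field_simp
  rw [hexp] at hb3
  refine (measureReal_mono hsub).trans ((measureReal_union_le _ _).trans ?_)
  have := measureReal_union_le (μ := P) {ω | ∃ g : Fin (K * r) → Fin n × Bool,
      l2Norm (X ω *ᵥ signedSum g) ^ 2 < N * (c / 2 * l2Norm (signedSum g) ^ 2)}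
    (⋃ a, {ω | N * Γ ≤ ∑ i, X ω i a ^ 2})
  linarith

end Design

/-! ### Non-asymptotic error bound for a single model. -/

section ErrorBound

/-- With probability at least `1 - δ` the three errors of a single model have the asserted order.
For small `n` the noise is not dominated by the penalty with high probability; then the
restricted eigenvalue condition is used on the whole space. -/
lemma exists_error_bound (k : ℕ) {σ c ν : ℝ} (hσ : 0 < σ) (hc : 0 < c) (hν0 : 0 ≤ ν) :
    ∃ c₀ C₀ : ℝ, 0 < c₀ ∧ 0 < C₀ ∧ ∀ c₁ δ : ℝ, 0 < δ → ∃ M : ℝ, 0 < M ∧ ∃ N₀ : ℕ,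
      ∀ {Ω : Type*} [MeasurableSpace Ω] (P : Measure Ω) [IsProbabilityMeasure P]
      {N n s₁ s₂ : ℕ} {σε lam lamg : ℝ} {G : SimpleGraph (Fin n)}
      {S : Matrix (Fin n) (Fin n) ℝ} {X : Ω → Matrix (Fin N) (Fin n) ℝ} {ε : Ω → Fin N → ℝ}
      {b : Fin n → ℝ} {bh : Ω → Fin n → ℝ}, N₀ ≤ N → 2 ≤ n →
      C₀ * (s₂ * Real.log n) ≤ N → 0 < s₁ → 0 < s₂ → ν ≤ (s₂ : ℝ) / s₁ →
      b ∈ sparseClass G k s₁ s₂ → IsRowwiseSubGaussian σ S X P →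
      spectrum ℝ S ⊆ Set.Ici c → 0 < σε → IsSubGaussianNoise σε ε P →
      IndepFun (fun ω => fun (i : Fin N) (a : Fin n) => X ω i a) ε P →
      c₀ * (σε * Real.sqrt (Real.log n / N)) ≤ lam →
      lam ≤ c₁ * (σε * Real.sqrt (Real.log n / N)) →
      lamg = lam * Real.sqrt (ν / (2 * (maxDeg G : ℝ)) ^ (k + 1)) →
      (∀ᵐ ω ∂P, IsEstimate G k (X ω) (X ω *ᵥ b + ε ω) lamg lam (bh ω)) →
      P {ω | ¬ (l2Norm (bh ω - b) ≤ M * (σε * Real.sqrt (s₂ * Real.log n / N)) ∧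
        l1Norm (bh ω - b) ≤ M * (σε * s₂ * Real.sqrt (Real.log n / N)) ∧
        1 / (N : ℝ) * l2Norm (X ω *ᵥ (bh ω - b)) ^ 2
          ≤ M * (σε ^ 2 * (s₂ * Real.log n / N)))} ≤ ENNReal.ofReal δ := by
  obtain ⟨Γ, C, ρ, hΓ, hC, hρ, hdes⟩ := exists_design_constants hσ hc
  -- Twice the noise level `2 * Real.sqrt Γ` used for large `n`, so that λ dominates the noise with
  -- a factor 2 to spare.
  refine ⟨4 * Real.sqrt Γ, C, by positivity, hC, ?_⟩
  intro c₁ δ hδ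
  -- At that level the noise bound fails with probability at most 2/n, which is at most δ/2 once n ≥
  -- 4/δ.
  set n₀ : ℕ := ⌈4 / δ⌉₊ + 2 with hn₀
  set q : ℝ := |Real.log (4 / δ)| / Real.log 2 with hq
  have hlog2 : 0 < Real.log 2 := Real.log_pos one_lt_two
  have hq0 : 0 ≤ q := by positivity
  -- For small `n` the noise level depends on δ: the failure bound becomes 2 exp(-qL), and qL ≥
  -- log(4/δ) because L ≥ log 2.
  set A₁ : ℝ := Real.sqrt (2 * Γ * (1 + q)) with hA₁
  have hA₁0 : 0 ≤ A₁ := Real.sqrt_nonneg _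
  -- Serves both cases: the first summand pays for the penalties, the second for small `n`, where
  -- ‖e‖₁ ≤ √n₀ ‖e‖₂ and the noise may exceed λ.
  set B : ℝ := 6 * max c₁ 1 + (2 * A₁ + 1) * Real.sqrt n₀ with hB
  have hc1 : 1 ≤ max c₁ 1 := le_max_right _ _
  have hB6 : 6 * max c₁ 1 ≤ B := by
    have : 0 ≤ (2 * A₁ + 1) * Real.sqrt n₀ := by positivity
    linarith
  have hB0 : 0 < B := by linarith
  set κ : ℝ := c / 4 with hκ
  have hκ0 : 0 < κ := by positivity
  obtain ⟨N₁, hN₁⟩ : ∃ N₁ : ℕ, ∀ N : ℕ, N₁ ≤ N → 2 * Real.exp (-(ρ * N)) ≤ δ / 2 := by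
    have h1 : Tendsto (fun N : ℕ => 2 * Real.exp (-(ρ * N))) atTop (𝓝 (2 * 0)) :=
      (Real.tendsto_exp_neg_atTop_nhds_zero.comp
        (tendsto_natCast_atTop_atTop.const_mul_atTop hρ)).const_mul 2
    rw [mul_zero] at h1
    exact eventually_atTop.mp (h1.eventually_le_const (half_pos hδ))
  refine ⟨B / κ + B ^ 2 / κ, by positivity, N₁ + ⌈C * (n₀ * Real.log n₀)⌉₊ + 1, ?_⟩
  intro Ω _ P _ N n s₁ s₂ σε lam lamg G S X ε b bh hN hn hCN hs₁ hs₂ hν hb hX hspec hσε hε hind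
    hlo hhi hlamg hest
  have hNpos : 0 < N := by omega
  have hN' : (0 : ℝ) < N := by exact_mod_cast hNpos
  have hn2 : (2 : ℝ) ≤ n := by exact_mod_cast hn
  have hs1 : (1 : ℝ) ≤ s₂ := by exact_mod_cast hs₂
  have hL2 : Real.log 2 ≤ Real.log n := Real.log_le_log two_pos hn2
  have hL0 : 0 < Real.log n := hlog2.trans_le hL2
  set L := Real.log n with hL
  have hnL : (n : ℝ) = Real.exp L := (Real.exp_log (by linarith)).symm
  set τ : ℝ := σε * Real.sqrt (L / N) with hτ
  have hτ0 : 0 ≤ τ := by positivity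
  have hlam0 : 0 ≤ lam := le_trans (by positivity) hlo
  have hlamτ : lam ≤ max c₁ 1 * τ := hhi.trans (by gcongr; exact le_max_left _ _)
  have hexpN : 2 * Real.exp (-(ρ * N)) ≤ δ / 2 := hN₁ N (by omega)
  have hη : ∀ A : ℝ, A * (σε * Real.sqrt (N * L)) = N * (A * τ) := by
    intro A
    have h1 : Real.sqrt (N * L) = N * Real.sqrt (L / N) := by
      rw [show (N : ℝ) * L = N ^ 2 * (L / N) by field_simp, Real.sqrt_mul (by positivity),
        Real.sqrt_sq hN'.le]
    rw [h1, hτ]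
    ring
  -- it remains to find suitable `r` and `A`
  suffices key : ∃ (r : ℕ) (A : ℝ), 0 < r ∧ C * (r * L) ≤ N ∧ 0 ≤ A ∧
      n * (2 * Real.exp (-(A ^ 2 * L / (2 * Γ)))) ≤ δ / 2 ∧
      ∀ x y z : ℝ, 0 ≤ x → 0 ≤ y → y ≤ Real.sqrt n * x → 0 ≤ z →
        1 / 2 * z ≤ 3 * lam * (Real.sqrt s₂ * x) + (A * τ - lam) * y →
        y ^ 2 ≤ 36 * (r * x ^ 2) ∧ y ≤ B * (Real.sqrt s₂ * x) ∧
          z ≤ B * τ * (Real.sqrt s₂ * x) by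
    obtain ⟨r, A, hr, hCr, hA, hprob, hdet⟩ := key
    have h1 := hdes P hNpos hn hr hCr hX hspec hσε hε hind hA
    have h2 := h1.trans (by linarith : _ ≤ δ)
    rw [measureReal_def] at h2
    have h3 := (ENNReal.le_ofReal_iff_toReal_le (measure_ne_top _ _) hδ.le).mpr h2
    -- Almost-everywhere monotonicity of the outer measure needs no measurability of the bad set or
    -- of the estimate.
    refine le_trans (measure_mono_ae ?_) h3
    filter_upwards [hest] with ω hω hbad
    refine fun hgood => hbad ?_
    obtain ⟨hre, hnoise⟩ := hgood
    have h4 := basic_inequality G hNpos hlam0 hs₁ hν0 hν hlamg hb hω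
      (fun a => (hnoise a).trans_eq (hη A))
    set e := bh ω - b with he
    have h5 : l1Norm e ≤ Real.sqrt n * l2Norm e := by
      simpa using l1Norm_le_sqrt_card_mul_l2Norm e
    obtain ⟨hcone, hy, hz⟩ := hdet (l2Norm e) (l1Norm e) (1 / (N : ℝ) * l2Norm (X ω *ᵥ e) ^ 2)
      (l2Norm_nonneg e) (l1Norm_nonneg e) h5 (by positivity)
      (le_trans (le_of_eq (by field_simp)) h4)
    obtain ⟨e1, e2, e3⟩ := error_bounds hκ0 (by linarith : (0 : ℝ) ≤ s₂) hB0.le hτ0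
      (l2Norm_nonneg e) hy hz (hre e hcone)
    have hBκ : 0 ≤ B / κ := by positivity
    have hBκ2 : 0 ≤ B ^ 2 / κ := by positivity
    have t1 : σε * Real.sqrt (s₂ * L / N) = τ * Real.sqrt s₂ := by
      rw [hτ, mul_div_assoc, Real.sqrt_mul (by positivity)]
      ring
    have t2 : σε * s₂ * Real.sqrt (L / N) = τ * s₂ := by
      rw [hτ]
      ring
    have t3 : σε ^ 2 * (s₂ * L / N) = τ ^ 2 * s₂ := by
      rw [hτ, mul_pow, Real.sq_sqrt (by positivity)]
      ring
    rw [t1, t2, t3]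
    refine ⟨e1.trans ?_, e2.trans ?_, e3.trans ?_⟩
    · gcongr
      linarith
    · gcongr
      linarith
    · gcongr
      linarith
  rcases le_or_gt n₀ n with hcase | hcase
  · refine ⟨s₂, 2 * Real.sqrt Γ, hs₂, hCN, by positivity, ?_, ?_⟩
    · have h1 : (2 * Real.sqrt Γ) ^ 2 * L / (2 * Γ) = L + L := by
        rw [mul_pow, Real.sq_sqrt hΓ.le]
        field_simp
        ring
      have h2 : 4 / δ ≤ n := by
        refine (Nat.le_ceil _).trans ?_
        exact_mod_cast (show ⌈4 / δ⌉₊ ≤ n by omega)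
      rw [h1, neg_add, Real.exp_add, Real.exp_neg, ← hnL]
      rw [div_le_iff₀ hδ] at h2
      have h3 : (n : ℝ) * (2 * ((n : ℝ)⁻¹ * (n : ℝ)⁻¹)) = 2 / n := by field_simp
      rw [h3, div_le_iff₀ (by linarith)]
      linarith
    · intro x y z hx hy _ hz hbasic
      have h1 : (2 * Real.sqrt Γ * τ - lam) * y ≤ -(lam / 2) * y := by
        gcongr
        linarith
      have hlampos : 0 < lam := by
        refine lt_of_lt_of_le ?_ hlo
        positivity
      have h2 : y ≤ 6 * (Real.sqrt s₂ * x) := by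
        have h3 : lam * y ≤ lam * (6 * (Real.sqrt s₂ * x)) := by linarith
        exact le_of_mul_le_mul_left h3 hlampos
      have h4 : 0 ≤ Real.sqrt s₂ * x := by positivity
      refine ⟨?_, ?_, ?_⟩
      · calc y ^ 2 ≤ (6 * (Real.sqrt s₂ * x)) ^ 2 := by gcongr
          _ = 36 * (s₂ * x ^ 2) := by
            rw [mul_pow, mul_pow, Real.sq_sqrt (by positivity)]
            ring
      · refine h2.trans ?_
        gcongr
        linarith
      · have h5 : 0 ≤ lam / 2 * y := by positivity
        calc z ≤ 6 * lam * (Real.sqrt s₂ * x) := by linarith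
          _ ≤ 6 * (max c₁ 1 * τ) * (Real.sqrt s₂ * x) := by gcongr
          _ = 6 * max c₁ 1 * τ * (Real.sqrt s₂ * x) := by ring
          _ ≤ _ := by gcongr
  -- With `r = n` Cauchy–Schwarz puts every vector in the cone; the required sample size C n log n
  -- is bounded by the choice of `N₀`.
  · refine ⟨n, A₁, by omega, ?_, hA₁0, ?_, ?_⟩
    · have h1 : (n : ℝ) ≤ n₀ := by exact_mod_cast hcase.le
      have h2 : L ≤ Real.log n₀ := Real.log_le_log (by linarith) h1
      calc C * (n * L) ≤ C * (n₀ * Real.log n₀) := by gcongr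
        _ ≤ (⌈C * (n₀ * Real.log n₀)⌉₊ : ℝ) := Nat.le_ceil _
        _ ≤ N := by exact_mod_cast (by omega : ⌈C * (n₀ * Real.log n₀)⌉₊ ≤ N)
    · have h1 : A₁ ^ 2 * L / (2 * Γ) = L + q * L := by
        rw [hA₁, Real.sq_sqrt (by positivity)]
        field_simp
      have h2 : Real.log (4 / δ) ≤ q * L := by
        calc Real.log (4 / δ) ≤ |Real.log (4 / δ)| := le_abs_self _
          _ = q * Real.log 2 := by rw [hq, div_mul_cancel₀ _ hlog2.ne']
          _ ≤ q * L := by gcongr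
      have h3 : Real.exp (-(q * L)) ≤ δ / 4 := by
        calc Real.exp (-(q * L)) ≤ Real.exp (-Real.log (4 / δ)) :=
              Real.exp_le_exp.mpr (by linarith)
          _ = δ / 4 := by rw [Real.exp_neg, Real.exp_log (by positivity), inv_div]
      rw [h1, neg_add, Real.exp_add, Real.exp_neg, ← hnL]
      have h4 : (n : ℝ) * (2 * ((n : ℝ)⁻¹ * Real.exp (-(q * L)))) = 2 * Real.exp (-(q * L)) := by
        field_simp
      rw [h4]
      linarith
    · intro x y z hx hy hyx hz hbasic
      have hnn : Real.sqrt n ≤ Real.sqrt n₀ :=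
        Real.sqrt_le_sqrt (by exact_mod_cast hcase.le)
      have hss : 1 ≤ Real.sqrt s₂ := by
        rw [Real.one_le_sqrt]
        exact hs1
      have h4 : 0 ≤ Real.sqrt s₂ * x := by positivity
      have hy2 : y ≤ Real.sqrt n₀ * (Real.sqrt s₂ * x) := by
        calc y ≤ Real.sqrt n * x := hyx
          _ ≤ Real.sqrt n₀ * (1 * x) := by
            rw [one_mul]
            gcongr
          _ ≤ _ := by gcongr
      have hn0 : 0 ≤ Real.sqrt n₀ := Real.sqrt_nonneg _
      have hAn : 0 ≤ A₁ * Real.sqrt n₀ := by positivity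
      refine ⟨?_, ?_, ?_⟩
      · calc y ^ 2 ≤ (Real.sqrt n * x) ^ 2 := by gcongr
          _ = n * x ^ 2 := by rw [mul_pow, Real.sq_sqrt (by positivity)]
          _ ≤ 36 * (n * x ^ 2) := by
            have : 0 ≤ (n : ℝ) * x ^ 2 := by positivity
            linarith
      · refine hy2.trans ?_
        gcongr
        rw [hB]
        linarith
      · have h5 : (A₁ * τ - lam) * y ≤ A₁ * τ * (Real.sqrt n₀ * (Real.sqrt s₂ * x)) := by
          calc (A₁ * τ - lam) * y ≤ A₁ * τ * y := by
                gcongr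
                linarith
            _ ≤ _ := by gcongr
        have h6 : 6 * lam * (Real.sqrt s₂ * x) ≤ 6 * (max c₁ 1 * τ) * (Real.sqrt s₂ * x) := by
          gcongr
        have h7 : 0 ≤ Real.sqrt n₀ * (τ * (Real.sqrt s₂ * x)) := by positivity
        rw [hB]
        linarith

end ErrorBound

end GraphLasso

end

theorem theorem2
    (k : ℕ) (σx cmin cmax ν : ℝ) (hσx : 0 < σx) (hcmin : 0 < cmin) (hcmax : 0 < cmax)
    (hν0 : 0 ≤ ν) (hν1 : ν < 1) :
    ∃ c₀ C₀ : ℝ, 0 < c₀ ∧ 0 < C₀ ∧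
    ∀ (c₁ : ℝ)
      (N n s₁ s₂ : ℕ → ℕ)
      (σε lam lamg : ℕ → ℝ)
      (G : ∀ j, SimpleGraph (Fin (n j)))
      (Ω : ℕ → Type*) [∀ j, MeasurableSpace (Ω j)]
      (P : ∀ j, Measure (Ω j)) [∀ j, IsProbabilityMeasure (P j)]
      (S : ∀ j, Matrix (Fin (n j)) (Fin (n j)) ℝ)
      (X : ∀ j, Ω j → Matrix (Fin (N j)) (Fin (n j)) ℝ)
      (ε : ∀ j, Ω j → Fin (N j) → ℝ)
      (βstar : ∀ j, Fin (n j) → ℝ)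
      (βhat : ∀ j, Ω j → Fin (n j) → ℝ),
      -- dimensions and sample size
      Tendsto N atTop atTop →
      (∀ j, 2 ≤ n j) →
      (∀ j, C₀ * ((s₂ j : ℝ) * Real.log (n j)) ≤ (N j : ℝ)) →
      -- the regression vector
      (∀ j, 0 < s₁ j) →
      (∀ j, 0 < s₂ j) →
      (∀ j, ν ≤ (s₂ j : ℝ) / (s₁ j : ℝ)) →
      (∀ j, βstar j ∈ GraphLasso.sparseClass (G j) k (s₁ j) (s₂ j)) →
      -- the random design
      (∀ j, GraphLasso.IsRowwiseSubGaussian σx (S j) (X j) (P j)) →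
      (∀ j, spectrum ℝ (S j) ⊆ Set.Icc cmin cmax) →
      -- the noise
      (∀ j, 0 < σε j) →
      (∀ j, GraphLasso.IsSubGaussianNoise (σε j) (ε j) (P j)) →
      (∀ j, IndepFun (fun ω => fun (i : Fin (N j)) (a : Fin (n j)) => X j ω i a) (ε j) (P j)) →
      -- the tuning parameters
      (∀ j, c₀ * (σε j * Real.sqrt (Real.log (n j) / (N j : ℝ))) ≤ lam j) →
      (∀ j, lam j ≤ c₁ * (σε j * Real.sqrt (Real.log (n j) / (N j : ℝ)))) →
      (∀ j, lamg j =
        lam j * Real.sqrt (ν / (2 * (GraphLasso.maxDeg (G j) : ℝ)) ^ (k + 1))) →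
      -- the estimator, computed from `X` and `y = X β* + ε`
      (∀ j, ∀ᵐ ω ∂(P j), GraphLasso.IsEstimate (G j) k (X j ω) (X j ω *ᵥ βstar j + ε j ω)
        (lamg j) (lam j) (βhat j ω)) →
      GraphLasso.IsBigOP P (fun j ω => GraphLasso.l2Norm (βhat j ω - βstar j))
        (fun j => σε j * Real.sqrt ((s₂ j : ℝ) * Real.log (n j) / (N j : ℝ))) ∧
      GraphLasso.IsBigOP P (fun j ω => GraphLasso.l1Norm (βhat j ω - βstar j))
        (fun j => σε j * (s₂ j : ℝ) * Real.sqrt (Real.log (n j) / (N j : ℝ))) ∧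
      GraphLasso.IsBigOP P
        (fun j ω =>
          1 / (N j : ℝ) * GraphLasso.l2Norm (X j ω *ᵥ (βhat j ω - βstar j)) ^ 2)
        (fun j => σε j ^ 2 * ((s₂ j : ℝ) * Real.log (n j) / (N j : ℝ))) := by
  obtain ⟨c₀, C₀, hc₀, hC₀, hbound⟩ := GraphLasso.exists_error_bound k hσx hcmin hν0
  refine ⟨c₀, C₀, hc₀, hC₀, ?_⟩
  intro c₁ N n s₁ s₂ σε lam lamg G Ω _ P _ S X ε βstar βhat hN hn hCN hs₁ hs₂ hν hβ hX hspec hσε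
    hε hind hlo hhi hlamg hest
  -- A single event carries all three bounds. The `M` and `N₀` for a given δ are uniform over
  -- models, so N → ∞ is used only to pass `N₀`.
  have key : ∀ δ : ℝ, 0 < δ → ∃ M : ℝ, 0 < M ∧ ∀ᶠ j in atTop,
      P j {ω | ¬ (GraphLasso.l2Norm (βhat j ω - βstar j)
          ≤ M * (σε j * Real.sqrt ((s₂ j : ℝ) * Real.log (n j) / (N j : ℝ))) ∧
        GraphLasso.l1Norm (βhat j ω - βstar j)
          ≤ M * (σε j * (s₂ j : ℝ) * Real.sqrt (Real.log (n j) / (N j : ℝ))) ∧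
        1 / (N j : ℝ) * GraphLasso.l2Norm (X j ω *ᵥ (βhat j ω - βstar j)) ^ 2
          ≤ M * (σε j ^ 2 * ((s₂ j : ℝ) * Real.log (n j) / (N j : ℝ))))}
        ≤ ENNReal.ofReal δ := by
    intro δ hδ
    obtain ⟨M, hM, N₀, h⟩ := hbound c₁ δ hδ
    refine ⟨M, hM, ?_⟩
    filter_upwards [hN.eventually_ge_atTop N₀] with j hj
    exact h (P j) hj (hn j) (hCN j) (hs₁ j) (hs₂ j) (hν j) (hβ j) (hX j)
      ((hspec j).trans Set.Icc_subset_Ici_self) (hσε j) (hε j) (hind j) (hlo j) (hhi j) (hlamg j)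
      (hest j)
  refine ⟨fun δ hδ => ?_, fun δ hδ => ?_, fun δ hδ => ?_⟩
  all_goals
    obtain ⟨M, hM, h⟩ := key δ hδ
    refine ⟨M, hM, ?_⟩
    filter_upwards [h] with j hj
    refine (measure_mono fun ω hω hgood => ?_).trans hj
    obtain ⟨h1, h2, h3⟩ := hgood
    rw [Set.mem_ofPred_eq] at hω
  · rw [abs_of_nonneg (GraphLasso.l2Norm_nonneg _)] at hω
    exact absurd h1 (not_le.mpr hω)
  · rw [abs_of_nonneg (GraphLasso.l1Norm_nonneg _)] at hω
    exact absurd h2 (not_le.mpr hω)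
  · rw [abs_of_nonneg (by positivity)] at hω
    exact absurd h3 (not_le.mpr hω)
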